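/- Let $r\ge 1$, $m,n,l$ be integers, let $x^{(1)},\dots,x^{(l)}\in\mathbb R^n$ and $y^{(1)},\dots,y^{(l)}\in\mathbb R^m$ (Euclidean norms), let $\beta\ge 0$ and $s\in\mathbb R$, and let $t\in(0,1)$. Let $\mathbf m=(\mathbf m_0,\dots,\mathbf m_{r+1})$ be real numbers with $\mathbf m_0=1$, $\mathbf m_{r+1}=0$ and $\mathbf m_k\neq 0$ for $1\le k\le r$, and let $1\ge p_0\ge p_1\ge\dots\ge p_r\ge p_{r+1}=0$ and $1\ge q_0\ge q_1\ge\dots\ge q_r\ge q_{r+1}=0$. Let all components of $G\in\mathbb R^{m\times n}$ and, for $1\le k\le r+1$, of $u^{(4,k)}\in\mathbb R$, $u^{(2,k)}\in\mathbb R^m$, $h^{(k)}\in\mathbb R^n$ be independent centered normal variables with variances $1$, $p_{k-1}q_{k-1}-p_kq_k$, $p_{k-1}-p_k$ and $q_{k-1}-q_k$, respectively. Put $\mathcal U_k=[u^{(4,k)},u^{(2,k)},h^{(k)}]$, and let $\mathbb E_{\mathcal U_k}$ be the expectation over $\mathcal U_k$ only. Let $$D_0^{(i_1,i_2)}=\sqrt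 t\,(y^{(i_2)})^TGx^{(i_1)}+\sqrt{1-t}\,\|x^{(i_1)}\|(y^{(i_2)})^T\sum_{k=1}^{r+1}u^{(2,k)}+\sqrt t\,\|x^{(i_1)}\|\|y^{(i_2)}\|\sum_{k=1}^{r+1}u^{(4,k)}+\sqrt{1-t}\,\|y^{(i_2)}\|\Big(\sum_{k=1}^{r+1}h^{(k)}\Big)^Tx^{(i_1)},$$ $A^{(i_1,i_2)}=e^{\beta D_0^{(i_1,i_2)}}$, $C^{(i_1)}=\sum_{i_2=1}^lA^{(i_1,i_2)}$, $Z=\sum_{i_1=1}^l(C^{(i_1)})^s$, and $\zeta_0=Z$, $\zeta_k=\mathbb E_{\mathcal U_k}\zeta_{k-1}^{\mathbf m_k/\mathbf m_{k-1}}$ for $1\le k\le r$. Consider $$\psi(t)=\mathbb E_{G,\mathcal U_{r+1}}\frac{1}{\beta|s|\sqrt n\,\mathbf m_r}\log\zeta_r$$ (in the degenerate case $\beta|s|\sqrt n=0$, division by zero is read as giving $0$, so that both sides below are $0$). For $1\le k\le r$ let $\Phi_{\mathcal U_k}(F)=\mathbb E_{\mathcal U_k}\big(\zeta_{k-1}^{\mathbf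 m_k/\mathbf m_{k-1}}\zeta_k^{-1}F\big)$, write $\prod_{v=b}^{a}\Phi_{\mathcal U_v}=\Phi_{\mathcal U_b}\Phi_{\mathcal U_{b-1}}\cdots\Phi_{\mathcal U_a}$ (the identity if $b<a$), and let $$\gamma_0(i_1,i_2)=\frac{(C^{(i_1)})^s}{Z}\frac{A^{(i_1,i_2)}}{C^{(i_1)}},\qquad \gamma_{01}^{(r)}(i_1,i_2)=\prod_{v=r}^{1}\Phi_{\mathcal U_v}\gamma_0(i_1,i_2),\qquad \gamma_{02}^{(r)}(i_1,i_2,p_2)=\prod_{v=r}^{1}\Phi_{\mathcal U_v}\Big(\frac{(C^{(i_1)})^s}{Z}\frac{A^{(i_1,i_2)}A^{(i_1,p_2)}}{(C^{(i_1)})^2}\Big),$$ $$\gamma_k^{(r)}(i_1,i_2,p_1,p_2)=\prod_{v=r}^{k}\Phi_{\mathcal U_v}\Big(\prod_{v=k-1}^{1}\Phi_{\mathcal U_v}\gamma_0(i_1,i_2)\cdot\prod_{v=k-1}^{1}\Phi_{\mathcal U_v}\gamma_0(p_1,p_2)\Big),\qquad 1\le k\le r+1.$$ With $\langle\cdot\rangle_\gamma$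 the sum over all indices weighted by $\gamma$, let, for $1\le k\le r+1$, $$\phi_k^{(r)}=-s(\mathbf m_{k-1}-\mathbf m_k)\,\mathbb E_{G,\mathcal U_{r+1}}\Big\langle\big(p_{k-1}\|x^{(i_1)}\|\|x^{(p_1)}\|-(x^{(p_1)})^Tx^{(i_1)}\big)\big(q_{k-1}\|y^{(i_2)}\|\|y^{(p_2)}\|-(y^{(p_2)})^Ty^{(i_2)}\big)\Big\rangle_{\gamma_k^{(r)}},$$ $$\phi_{01}^{(r)}=(1-p_0)(1-q_0)\,\mathbb E_{G,\mathcal U_{r+1}}\big\langle\|x^{(i_1)}\|^2\|y^{(i_2)}\|^2\big\rangle_{\gamma_{01}^{(r)}},$$ $$\phi_{02}^{(r)}=-(s-1)(1-p_0)\,\mathbb E_{G,\mathcal U_{r+1}}\Big\langle\|x^{(i_1)}\|^2\big(q_0\|y^{(i_2)}\|\|y^{(p_2)}\|-(y^{(p_2)})^Ty^{(i_2)}\big)\Big\rangle_{\gamma_{02}^{(r)}}.$$ Then $\psi$ is differentiable at $t$ and $$\frac{d\psi}{dt}(t)=\frac{\operatorname{sign}(s)\,\beta}{2\sqrt n}\Big(\sum_{k=1}^{r+1}\phi_k^{(r)}+\phi_{01}^{(r)}+\phi_{02}^{(r)}\Big).$$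 In particular, if $p_0=q_0=1$, then $\frac{d\psi}{dt}(t)=\frac{\operatorname{sign}(s)\,\beta}{2\sqrt n}\sum_{k=1}^{r+1}\phi_k^{(r)}$. -/

import Mathlib

namespace FullLifting

open MeasureTheory ProbabilityTheory

noncomputable section

/-- One Gaussian layer `𝒰 = [u⁽⁴⁾, u⁽²⁾, h]` with `u⁽⁴⁾ ∈ ℝ`, `u⁽²⁾ ∈ ℝ^m`, `h ∈ ℝ^n`. -/
abbrev Layer (m n : ℕ) : Type := ℝ × (Fin m → ℝ) × (Fin n → ℝ)

/-- A realization of all the randomness: the `m × n` matrix `G` and the layers `𝒰_k`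
(only the layers with `1 ≤ k ≤ r + 1` are ever used). -/
abbrev Sample (m n : ℕ) : Type := (Fin m → Fin n → ℝ) × (ℕ → Layer m n)

/-- Law of a vector in `ℝ^d` with i.i.d. centered normal components of variance `v`. -/
def gaussVec (d : ℕ) (v : ℝ) : Measure (Fin d → ℝ) :=
  Measure.pi fun _ => gaussianReal 0 v.toNNReal

/-- Law of `G`: i.i.d. standard normal entries. -/
def matLaw (m n : ℕ) : Measure (Fin m → Fin n → ℝ) :=
  Measure.pi fun _ => Measure.pi fun _ => gaussianReal 0 1

/-- Law of the layer `𝒰_k`, `k ≥ 1`: independent centered normal components with variances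
`p_{k-1} q_{k-1} - p_k q_k`, `p_{k-1} - p_k` and `q_{k-1} - q_k`. -/
def layerLaw (m n : ℕ) (p q : ℕ → ℝ) (k : ℕ) : Measure (Layer m n) :=
  (gaussianReal 0 (p (k - 1) * q (k - 1) - p k * q k).toNNReal).prod
    ((gaussVec m (p (k - 1) - p k)).prod (gaussVec n (q (k - 1) - q k)))

section

variable {m n l : ℕ}

/-- The partial expectation `𝔼_{𝒰_k} F`: average over the layer `k`, all the other
randomness being kept fixed. -/
def layerExp (p q : ℕ → ℝ) (k : ℕ) (F : Sample m n → ℝ) (ω : Sample m n) : ℝ :=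
  ∫ u, F (ω.1, Function.update ω.2 k u) ∂(layerLaw m n p q k)

/-- The expectation `𝔼_{G, 𝒰_{r+1}} F`. It is applied only to `F` that have already been averaged
over the layers `1, …, r`, so the value `0` given to these layers is immaterial. -/
def outerExp (p q : ℕ → ℝ) (r : ℕ) (F : Sample m n → ℝ) : ℝ :=
  ∫ z, F (z.1, Function.update 0 (r + 1) z.2) ∂((matLaw m n).prod (layerLaw m n p q (r + 1)))

/-- The bilinearly indexed process `D_0^{(i₁,i₂)}`. -/
def D₀ (r : ℕ) (x : Fin l → EuclideanSpace ℝ (Fin n)) (y : Fin l → EuclideanSpace ℝ (Fin m))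
    (t : ℝ) (i₁ i₂ : Fin l) (ω : Sample m n) : ℝ :=
  √t * (∑ a, ∑ b, y i₂ a * ω.1 a b * x i₁ b)
    + √(1 - t) * ‖x i₁‖ * (∑ a, y i₂ a * ∑ k ∈ Finset.Icc 1 (r + 1), (ω.2 k).2.1 a)
    + √t * ‖x i₁‖ * ‖y i₂‖ * (∑ k ∈ Finset.Icc 1 (r + 1), (ω.2 k).1)
    + √(1 - t) * ‖y i₂‖ * (∑ b, (∑ k ∈ Finset.Icc 1 (r + 1), (ω.2 k).2.2 b) * x i₁ b)

/-- `A^{(i₁,i₂)} = exp(β D_0^{(i₁,i₂)})`. -/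
def A (r : ℕ) (x : Fin l → EuclideanSpace ℝ (Fin n)) (y : Fin l → EuclideanSpace ℝ (Fin m))
    (β t : ℝ) (i₁ i₂ : Fin l) (ω : Sample m n) : ℝ :=
  Real.exp (β * D₀ r x y t i₁ i₂ ω)

/-- `C^{(i₁)} = ∑_{i₂} A^{(i₁,i₂)}`. -/
def C (r : ℕ) (x : Fin l → EuclideanSpace ℝ (Fin n)) (y : Fin l → EuclideanSpace ℝ (Fin m))
    (β t : ℝ) (i₁ : Fin l) (ω : Sample m n) : ℝ :=
  ∑ i₂, A r x y β t i₁ i₂ ω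

/-- `Z = ∑_{i₁} (C^{(i₁)})^s`. -/
def Z (r : ℕ) (x : Fin l → EuclideanSpace ℝ (Fin n)) (y : Fin l → EuclideanSpace ℝ (Fin m))
    (β s t : ℝ) (ω : Sample m n) : ℝ :=
  ∑ i₁, C r x y β t i₁ ω ^ s

/-- `ζ_0 = Z` and `ζ_k = 𝔼_{𝒰_k} ζ_{k-1}^{c_k / c_{k-1}}`; `c` is the vector of exponents. -/
def ζ (r : ℕ) (x : Fin l → EuclideanSpace ℝ (Fin n)) (y : Fin l → EuclideanSpace ℝ (Fin m))
    (p q c : ℕ → ℝ) (β s t : ℝ) : ℕ → Sample m n → ℝ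
  | 0 => Z r x y β s t
  | k + 1 => layerExp p q (k + 1) fun ω => ζ r x y p q c β s t k ω ^ (c (k + 1) / c k)

/-- The interpolating function `ψ(t) = 𝔼_{G, 𝒰_{r+1}} (β |s| √n c_r)⁻¹ log ζ_r`. -/
def ψ (r : ℕ) (x : Fin l → EuclideanSpace ℝ (Fin n)) (y : Fin l → EuclideanSpace ℝ (Fin m))
    (p q c : ℕ → ℝ) (β s t : ℝ) : ℝ :=
  outerExp p q r fun ω => 1 / (β * |s| * √n * c r) * Real.log (ζ r x y p q c β s t r ω)

/-- The operator `Φ_{𝒰_k} F = 𝔼_{𝒰_k} (ζ_{k-1}^{c_k / c_{k-1}} / ζ_k · F)`, `k ≥ 1`. -/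
def Φ (r : ℕ) (x : Fin l → EuclideanSpace ℝ (Fin n)) (y : Fin l → EuclideanSpace ℝ (Fin m))
    (p q c : ℕ → ℝ) (β s t : ℝ) (k : ℕ) (F : Sample m n → ℝ) : Sample m n → ℝ :=
  layerExp p q k fun ω =>
    ζ r x y p q c β s t (k - 1) ω ^ (c k / c (k - 1)) / ζ r x y p q c β s t k ω * F ω

/-- The composition `Φ_{𝒰_b} Φ_{𝒰_{b-1}} ⋯ Φ_{𝒰_a}`, the identity when `b < a`. -/
def Φchain (r : ℕ) (x : Fin l → EuclideanSpace ℝ (Fin n)) (y : Fin l → EuclideanSpace ℝ (Fin m))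
    (p q c : ℕ → ℝ) (β s t : ℝ) (a : ℕ) : ℕ → (Sample m n → ℝ) → Sample m n → ℝ
  | 0, F => F
  | b + 1, F =>
    if a ≤ b + 1 then Φ r x y p q c β s t (b + 1) (Φchain r x y p q c β s t a b F) else F

/-- The Gibbs weight `γ_0(i₁,i₂) = (C^{(i₁)})^s / Z · A^{(i₁,i₂)} / C^{(i₁)}`. -/
def γ₀ (r : ℕ) (x : Fin l → EuclideanSpace ℝ (Fin n)) (y : Fin l → EuclideanSpace ℝ (Fin m))
    (β s t : ℝ) (i₁ i₂ : Fin l) (ω : Sample m n) : ℝ :=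
  C r x y β t i₁ ω ^ s / Z r x y β s t ω * (A r x y β t i₁ i₂ ω / C r x y β t i₁ ω)

/-- `γ_{01}(i₁,i₂) = Φ_{𝒰_r} ⋯ Φ_{𝒰_1} γ_0(i₁,i₂)`. -/
def γ₀₁ (r : ℕ) (x : Fin l → EuclideanSpace ℝ (Fin n)) (y : Fin l → EuclideanSpace ℝ (Fin m))
    (p q c : ℕ → ℝ) (β s t : ℝ) (i₁ i₂ : Fin l) : Sample m n → ℝ :=
  Φchain r x y p q c β s t 1 r (γ₀ r x y β s t i₁ i₂)

/-- `γ_{02}(i₁,i₂,p₂) = Φ_{𝒰_r} ⋯ Φ_{𝒰_1} ((C^{(i₁)})^s / Z · A^{(i₁,i₂)} / C^{(i₁)} ·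
A^{(i₁,p₂)} / C^{(i₁)})`: one draw of the first index, two conditionally independent draws of the
second one. -/
def γ₀₂ (r : ℕ) (x : Fin l → EuclideanSpace ℝ (Fin n)) (y : Fin l → EuclideanSpace ℝ (Fin m))
    (p q c : ℕ → ℝ) (β s t : ℝ) (i₁ i₂ p₂ : Fin l) : Sample m n → ℝ :=
  Φchain r x y p q c β s t 1 r fun ω =>
    C r x y β t i₁ ω ^ s / Z r x y β s t ω
      * (A r x y β t i₁ i₂ ω / C r x y β t i₁ ω) * (A r x y β t i₁ p₂ ω / C r x y β t i₁ ω)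

/-- For `1 ≤ k ≤ r + 1`, the weight `γ_k(i₁,i₂,p₁,p₂) = Φ_{𝒰_r} ⋯ Φ_{𝒰_k}
((Φ_{𝒰_{k-1}} ⋯ Φ_{𝒰_1} γ_0(i₁,i₂)) (Φ_{𝒰_{k-1}} ⋯ Φ_{𝒰_1} γ_0(p₁,p₂)))`. -/
def γ (r : ℕ) (x : Fin l → EuclideanSpace ℝ (Fin n)) (y : Fin l → EuclideanSpace ℝ (Fin m))
    (p q c : ℕ → ℝ) (β s t : ℝ) (k : ℕ) (i₁ i₂ p₁ p₂ : Fin l) : Sample m n → ℝ :=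
  Φchain r x y p q c β s t k r fun ω =>
    Φchain r x y p q c β s t 1 (k - 1) (γ₀ r x y β s t i₁ i₂) ω
      * Φchain r x y p q c β s t 1 (k - 1) (γ₀ r x y β s t p₁ p₂) ω

/-- `φ_k = -s (c_{k-1} - c_k) 𝔼_{G, 𝒰_{r+1}} ⟨(p_{k-1} ‖x‖ ‖x'‖ - x'ᵀx) (q_{k-1} ‖y‖ ‖y'‖ - y'ᵀy)⟩`,
the average `⟨·⟩` being with respect to `γ_k`. -/
def φ (r : ℕ) (x : Fin l → EuclideanSpace ℝ (Fin n)) (y : Fin l → EuclideanSpace ℝ (Fin m))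
    (p q c : ℕ → ℝ) (β s t : ℝ) (k : ℕ) : ℝ :=
  -s * (c (k - 1) - c k) * outerExp p q r fun ω =>
    ∑ i₁, ∑ i₂, ∑ p₁, ∑ p₂,
      (p (k - 1) * (‖x i₁‖ * ‖x p₁‖) - inner ℝ (x p₁) (x i₁))
        * (q (k - 1) * (‖y i₂‖ * ‖y p₂‖) - inner ℝ (y p₂) (y i₂))
        * γ r x y p q c β s t k i₁ i₂ p₁ p₂ ω

/-- `φ_{01} = (1 - p_0) (1 - q_0) 𝔼_{G, 𝒰_{r+1}} ⟨‖x‖² ‖y‖²⟩`, averaged over `γ_{01}`. -/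
def φ₀₁ (r : ℕ) (x : Fin l → EuclideanSpace ℝ (Fin n)) (y : Fin l → EuclideanSpace ℝ (Fin m))
    (p q c : ℕ → ℝ) (β s t : ℝ) : ℝ :=
  (1 - p 0) * (1 - q 0) * outerExp p q r fun ω =>
    ∑ i₁, ∑ i₂, ‖x i₁‖ ^ 2 * ‖y i₂‖ ^ 2 * γ₀₁ r x y p q c β s t i₁ i₂ ω

/-- `φ_{02} = -(s - 1) (1 - p_0) 𝔼_{G, 𝒰_{r+1}} ⟨‖x‖² (q_0 ‖y‖ ‖y'‖ - y'ᵀy)⟩`, averaged over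
`γ_{02}`. -/
def φ₀₂ (r : ℕ) (x : Fin l → EuclideanSpace ℝ (Fin n)) (y : Fin l → EuclideanSpace ℝ (Fin m))
    (p q c : ℕ → ℝ) (β s t : ℝ) : ℝ :=
  -(s - 1) * (1 - p 0) * outerExp p q r fun ω =>
    ∑ i₁, ∑ i₂, ∑ p₂,
      ‖x i₁‖ ^ 2 * (q 0 * (‖y i₂‖ * ‖y p₂‖) - inner ℝ (y p₂) (y i₂))
        * γ₀₂ r x y p q c β s t i₁ i₂ p₂ ω

end

end

end FullLifting

open MeasureTheory ProbabilityTheory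

/-! Given the later layers, `D₀` is a fixed vector `v` plus a Gaussian vector `X_t` whose
coefficients are constants times `√t` or `√(1 - t)`. All quantities thus become functions of `(t,
v)`. Gaussian integration by parts gives a heat equation: averaging `g(t, v + X_t)` adds to the
averaged time derivative the contraction of `E[X_t' ⊗ X_t]` with the averaged Hessian (`IsJet.avg`).

For a positive `W` carrying an exponent `c`, the right data are the time derivative `h` and gradient
`d` of `log W / c`, together with `q = Hess W / (c W)`. Passing to `W ^ (c' / c)` keeps `h` and `d`
and changes `q` to `q - (c - c') d ⊗ d` (`IsLogJet.rpow`). Averaging replaces `d` and `q` by their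
reweighted averages, and adds the heat term to that of `h` (`IsLogJet.avg`). These reweighted
averages are the operators `Φ`.

Layer `k + 1` has `E[X_t' ⊗ X_t] = κ_k - κ_{k+1}`, where `κ_k` is half the product of the two
overlap factors of level `k` (`layer_covariance`). The induction in `isLogJet_tower` maintains `h_k
= T_k - κ_k · q_k`, with `T_k` explicit. A further layer adds `(κ_k - κ_{k+1}) · (q_k - (c_k -
c_{k+1}) d ⊗ d)`, so the unknown `q_k` cancels against the inherited term, `-(c_k - c_{k+1}) κ_k · d
⊗ d` stays and becomes `φ_{k+1}`, and `-κ_{k+1} · q_{k+1}` is handed on. In the last average the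
logarithm plays the part of the exponent `c_{r+1} = 0`, and `G` contributes exactly the missing
`κ_{r+1}`, so that no Hessian is left (`hasDerivAt_avg_log_tower`).

At the bottom `h_0 = 0` and `T_0 = κ_0 · q_0`. The gradient datum of `Z` is `s β γ₀`, and its
Hessian lives on pairs of indices that agree entirely or in the first component (`isLogJet_gibbsZ`);
these two parts yield `φ₀₁` and `φ₀₂`. Differentiation under the integrals is justified by classes
of exponentially growing functions that are stable under every operation used. -/

namespace GaussianInterpolation

open Filter Topology

/-! ### Gaussian integration by parts. -/

section Gaussian

lemma integrable_exp_mul_abs_gaussianReal (v : NNReal) (B : ℝ) :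
    Integrable (fun x : ℝ => Real.exp (B * |x|)) (gaussianReal 0 v) :=
  integrable_exp_mul_abs (X := fun x : ℝ => x) (integrable_exp_mul_gaussianReal B)
    (integrable_exp_mul_gaussianReal (-B))

lemma abs_le_exp_abs (x : ℝ) : |x| ≤ Real.exp |x| := by
  linarith [Real.add_one_le_exp |x|]

/-- Gaussian integration by parts on the line. -/
lemma integral_mul_gaussianReal {v : NNReal} {f f' : ℝ → ℝ} {M B : ℝ}
    (hf : ∀ x, HasDerivAt f (f' x) x) (hf' : Continuous f')
    (hb : ∀ x, |f x| ≤ M * Real.exp (B * |x|)) (hb' : ∀ x, |f' x| ≤ M * Real.exp (B * |x|)) :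
    ∫ x, x * f x ∂gaussianReal 0 v = v * ∫ x, f' x ∂gaussianReal 0 v := by
  rcases eq_or_ne v 0 with rfl | hv
  -- Zero variance is the Dirac mass at `0`, which has no density; layers with equal consecutive `p`
  -- or `q` do lead to it.
  · simp [gaussianReal_zero_var]
  have hfc : Continuous f := continuous_iff_continuousAt.2 fun x => (hf x).continuousAt
  have hpdf : ∀ g : ℝ → ℝ, Integrable g (gaussianReal 0 v) →
      Integrable (fun x => gaussianPDFReal 0 v x * g x) := by
    intro g hg
    rw [gaussianReal_of_var_ne_zero _ hv,
      integrable_withDensity_iff_integrable_smul' (measurable_gaussianPDF _ _)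
        (ae_of_all _ fun x => gaussianPDF_lt_top)] at hg
    simpa [toReal_gaussianPDF] using hg
  have i0 : Integrable f (gaussianReal 0 v) :=
    ((integrable_exp_mul_abs_gaussianReal v B).const_mul M).mono' hfc.aestronglyMeasurable
      (ae_of_all _ fun x => hb x)
  have i1 : Integrable f' (gaussianReal 0 v) :=
    ((integrable_exp_mul_abs_gaussianReal v B).const_mul M).mono' hf'.aestronglyMeasurable
      (ae_of_all _ fun x => hb' x)
  have i2 : Integrable (fun x => x * f x) (gaussianReal 0 v) := by
    refine ((integrable_exp_mul_abs_gaussianReal v (B + 1)).const_mul M).mono'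
      (continuous_id.mul hfc).aestronglyMeasurable (ae_of_all _ fun x => ?_)
    rw [Real.norm_eq_abs, abs_mul, add_mul, one_mul, Real.exp_add, ← mul_assoc, mul_comm]
    exact mul_le_mul (hb x) (abs_le_exp_abs x) (abs_nonneg _) ((abs_nonneg _).trans (hb x))
  -- The density solves `ρ' = -(x / v) ρ`, so integration by parts against Lebesgue measure gives
  -- the formula.
  have hφ : ∀ x, HasDerivAt (gaussianPDFReal 0 v) (-(x / v) * gaussianPDFReal 0 v x) x := by
    intro x
    have h1 : HasDerivAt (fun x : ℝ => -(x - 0) ^ 2 / (2 * (v : ℝ))) (-(x / v)) x := by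
      have := ((((hasDerivAt_id x).sub_const 0).pow 2).neg).div_const (2 * (v : ℝ))
      refine this.congr_deriv ?_
      have : (v : ℝ) ≠ 0 := by exact_mod_cast hv
      simp
      field_simp
    have h2 := (h1.exp).const_mul (√(2 * Real.pi * (v : ℝ)))⁻¹
    rw [gaussianPDFReal_def]
    refine h2.congr_deriv ?_
    ring
  have key := integral_mul_deriv_eq_deriv_mul_of_integrable (u := f) (u' := f')
    (v := gaussianPDFReal 0 v) (v' := fun x => -(x / v) * gaussianPDFReal 0 v x)
    (fun x _ => hf x) (fun x _ => hφ x)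
    (by
      refine ((hpdf _ i2).const_mul (-(v : ℝ)⁻¹)).congr (ae_of_all _ fun x => ?_)
      simp only [Pi.mul_apply]; ring)
    (by
      refine (hpdf _ i1).congr (ae_of_all _ fun x => ?_)
      simp only [Pi.mul_apply]; ring)
    (by
      refine (hpdf _ i0).congr (ae_of_all _ fun x => ?_)
      simp only [Pi.mul_apply]; ring)
  rw [integral_gaussianReal_eq_integral_smul hv, integral_gaussianReal_eq_integral_smul hv]
  have e1 : ∫ x, f x * (-(x / v) * gaussianPDFReal 0 v x)
      = -(v : ℝ)⁻¹ * ∫ x, gaussianPDFReal 0 v x • (x * f x) := by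
    rw [← integral_const_mul]
    congr 1; ext x; simp only [smul_eq_mul]; ring
  have e2 : ∫ x, f' x * gaussianPDFReal 0 v x = ∫ x, gaussianPDFReal 0 v x • f' x := by
    congr 1; ext x; simp only [smul_eq_mul]; ring
  rw [e1, e2] at key
  have : (v : ℝ) ≠ 0 := by exact_mod_cast hv
  field_simp at key
  linarith

variable {J : Type*} [Fintype J]

/-- Law of a vector with independent centered normal coordinates of variances `σ`. -/
noncomputable def gaussPi (σ : J → NNReal) : Measure (J → ℝ) :=
  Measure.pi fun j => gaussianReal 0 (σ j)

instance (σ : J → NNReal) : IsProbabilityMeasure (gaussPi σ) := by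
  unfold gaussPi; infer_instance

lemma integrable_exp_sum_abs (σ : J → NNReal) (B : ℝ) :
    Integrable (fun z : J → ℝ => Real.exp (B * ∑ j, |z j|)) (gaussPi σ) := by
  have := Integrable.fintype_prod (μ := fun j => gaussianReal 0 (σ j))
    (f := fun _ x => Real.exp (B * |x|)) fun j => integrable_exp_mul_abs_gaussianReal (σ j) B
  refine this.congr (ae_of_all _ fun z => ?_)
  simp only [Finset.mul_sum, Real.exp_sum]

/-- Resampling one coordinate independently does not change a product law. This isolates a
coordinate without splitting the index type. -/
lemma measurePreserving_update [DecidableEq J] {X : J → Type*} [∀ j, MeasurableSpace (X j)]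
    (μ : ∀ j, Measure (X j)) [∀ j, IsProbabilityMeasure (μ j)] (j : J) :
    MeasurePreserving (fun w : (∀ j, X j) × X j => Function.update w.1 j w.2)
      ((Measure.pi μ).prod (μ j)) (Measure.pi μ) := by
  have hm : Measurable (fun w : (∀ j, X j) × X j => Function.update w.1 j w.2) := by
    refine measurable_pi_lambda _ fun i => ?_
    rcases eq_or_ne i j with rfl | h
    · simpa using measurable_snd
    · simp only [Function.update_of_ne h]
      exact (measurable_pi_apply i).comp measurable_fst
  refine ⟨hm, (Measure.pi_eq fun s hs => ?_).symm⟩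
  rw [Measure.map_apply hm (MeasurableSet.univ_pi hs)]
  have : (fun w : (∀ j, X j) × X j => Function.update w.1 j w.2) ⁻¹' (Set.univ.pi s)
      = (Set.univ.pi (Function.update s j Set.univ)) ×ˢ s j := by
    ext w
    simp only [Set.mem_preimage, Set.mem_univ_pi, Set.mem_prod]
    constructor
    · intro h
      refine ⟨fun i => ?_, by simpa using h j⟩
      rcases eq_or_ne i j with rfl | hi
      · simp
      · simpa [Function.update_of_ne hi] using h i
    · rintro ⟨h, h'⟩ i
      rcases eq_or_ne i j with rfl | hi
      · simpa using h'
      · simpa [Function.update_of_ne hi] using h i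
  rw [this, Measure.prod_prod, Measure.pi_pi, ← Finset.mul_prod_erase _ _ (Finset.mem_univ j),
    ← Finset.mul_prod_erase _ (fun i => μ i (s i)) (Finset.mem_univ j)]
  simp only [Function.update_self, measure_univ, one_mul]
  rw [mul_comm]
  congr 1
  refine Finset.prod_congr rfl fun i hi => ?_
  rw [Function.update_of_ne (Finset.ne_of_mem_erase hi)]

/-- Gaussian integration by parts in one of finitely many coordinates. -/
lemma integral_coord_mul_gaussPi [DecidableEq J] (σ : J → NNReal) (j : J)
    {f f' : (J → ℝ) → ℝ} {M B : ℝ} (hB : 0 ≤ B)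
    (hd : ∀ z u, HasDerivAt (fun u => f (Function.update z j u)) (f' (Function.update z j u)) u)
    (hf : Continuous f) (hf' : Continuous f')
    (hb : ∀ z : J → ℝ, |f z| ≤ M * Real.exp (B * ∑ j, |z j|))
    (hb' : ∀ z, |f' z| ≤ M * Real.exp (B * ∑ j, |z j|)) :
    ∫ z, z j * f z ∂gaussPi σ = σ j * ∫ z, f' z ∂gaussPi σ := by
  have hmp := measurePreserving_update (fun j => gaussianReal 0 (σ j)) j
  have hM : 0 ≤ M := by simpa using (abs_nonneg _).trans (hb 0)
  have hle : ∀ (z : J → ℝ) (u : ℝ), (∑ i, |Function.update z j u i|) ≤ (∑ i, |(z i : ℝ)|) + |u| := by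
    intro z u
    have h : ∑ i ∈ Finset.univ.erase j, |Function.update z j u i|
        = ∑ i ∈ Finset.univ.erase j, |z i| :=
      Finset.sum_congr rfl fun i hi => by
        rw [Function.update_of_ne (Finset.ne_of_mem_erase hi)]
    rw [← Finset.add_sum_erase _ _ (Finset.mem_univ j),
      ← Finset.add_sum_erase (Finset.univ) (fun i : J => |z i|) (Finset.mem_univ j), h]
    simp only [Function.update_self]
    linarith [abs_nonneg (z j)]
  have hgrow : ∀ g : (J → ℝ) → ℝ, (∀ z, |g z| ≤ M * Real.exp (B * ∑ j, |z j|)) →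
      ∀ z u, |g (Function.update z j u)|
        ≤ (M * Real.exp (B * ∑ i, |z i|)) * Real.exp (B * |u|) := by
    intro g hg z u
    refine (hg _).trans ?_
    rw [mul_assoc, ← Real.exp_add, ← mul_add]
    gcongr
    exact hle z u
  have i1 : Integrable f' (gaussPi σ) :=
    ((integrable_exp_sum_abs σ B).const_mul M).mono' hf'.aestronglyMeasurable
      (ae_of_all _ fun x => hb' x)
  have i2 : Integrable (fun z => z j * f z) (gaussPi σ) := by
    refine ((integrable_exp_sum_abs σ (B + 1)).const_mul M).mono'
      ((continuous_apply j).mul hf).aestronglyMeasurable (ae_of_all _ fun z => ?_)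
    rw [Real.norm_eq_abs, abs_mul, add_mul, one_mul, Real.exp_add, ← mul_assoc, mul_comm]
    refine mul_le_mul (hb z) ((abs_le_exp_abs _).trans ?_) (abs_nonneg _)
      ((abs_nonneg _).trans (hb z))
    gcongr
    exact Finset.single_le_sum (f := fun i => |z i|) (fun i _ => abs_nonneg _)
      (Finset.mem_univ j)
  unfold gaussPi at i1 i2 ⊢
  -- Fubini after resampling coordinate `j`, which reduces the claim to the formula on the line.
  have tr : ∀ g : (J → ℝ) → ℝ, Integrable g (Measure.pi fun j => gaussianReal 0 (σ j)) →
      ∫ z, g z ∂(Measure.pi fun j => gaussianReal 0 (σ j))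
        = ∫ z, ∫ u, g (Function.update z j u) ∂gaussianReal 0 (σ j)
            ∂(Measure.pi fun j => gaussianReal 0 (σ j)) := by
    intro g hg
    conv_lhs => rw [← hmp.map_eq]
    rw [integral_map hmp.measurable.aemeasurable (by rw [hmp.map_eq]; exact hg.1),
      integral_prod (fun w : (J → ℝ) × ℝ => g (Function.update w.1 j w.2))]
    exact hmp.integrable_comp_of_integrable hg
  rw [tr _ i2, tr _ i1, ← integral_const_mul]
  congr 1; ext z
  have := integral_mul_gaussianReal (v := σ j) (hd z)
    (hf'.comp (continuous_const.update j continuous_id)) (hgrow f hb z) (hgrow f' hb' z)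
  simpa using this

end Gaussian

/-! ### Functions of exponential growth, uniformly in time. -/

section Tame

variable {I : Type*} [Fintype I] {S : Set ℝ}

/-- Continuity in the space variable and exponential growth, uniform over the times in `S`. -/
structure Tame (S : Set ℝ) (f : ℝ → (I → ℝ) → ℝ) : Prop where
  cont : ∀ t ∈ S, Continuous (f t)
  bdd : ∃ B, 0 ≤ B ∧ ∀ t ∈ S, ∀ v, |f t v| ≤ Real.exp (B * (1 + ‖v‖))

/-- Positive functions, continuous in the space variable, that grow and decay at most
exponentially, uniformly over the times in `S`. -/
structure PosTame (S : Set ℝ) (W : ℝ → (I → ℝ) → ℝ) : Prop where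
  pos : ∀ t ∈ S, ∀ v, 0 < W t v
  cont : ∀ t ∈ S, Continuous (W t)
  bdd : ∃ B, 0 ≤ B ∧ ∀ t ∈ S, ∀ v, |Real.log (W t v)| ≤ B * (1 + ‖v‖)

namespace Tame

variable {f g : ℝ → (I → ℝ) → ℝ}

lemma of_time {φ : ℝ → ℝ} {K : ℝ} (h : ∀ t ∈ S, |φ t| ≤ K) :
    Tame S (fun t (_ : I → ℝ) => φ t) := by
  refine ⟨fun _ _ => continuous_const, |K|, abs_nonneg _, fun t ht v => ?_⟩
  have h1 : |K| ≤ |K| * (1 + ‖v‖) := by nlinarith [abs_nonneg K, norm_nonneg v]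
  linarith [h t ht, le_abs_self K, Real.add_one_le_exp (|K| * (1 + ‖v‖))]

lemma const (S : Set ℝ) (r : ℝ) : Tame S (fun _ (_ : I → ℝ) => r) :=
  of_time (φ := fun _ => r) (K := |r|) fun _ _ => le_rfl

/-- The growth bound carries no multiplicative constant; the factor `2` produced by a sum is
absorbed by raising the rate by `1`, since `2 ≤ exp (1 + ‖v‖)`. -/
lemma add (hf : Tame S f) (hg : Tame S g) : Tame S (fun t v => f t v + g t v) := by
  obtain ⟨B, hB, hfB⟩ := hf.bdd
  obtain ⟨D, hD, hgD⟩ := hg.bdd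
  refine ⟨fun t ht => (hf.cont t ht).add (hg.cont t ht), B + D + 1, by positivity,
    fun t ht v => ?_⟩
  have hv := norm_nonneg v
  have h1 : Real.exp (B * (1 + ‖v‖)) ≤ Real.exp ((B + D) * (1 + ‖v‖)) := by
    gcongr; linarith
  have h2 : Real.exp (D * (1 + ‖v‖)) ≤ Real.exp ((B + D) * (1 + ‖v‖)) := by
    gcongr; linarith
  have h3 : (2 : ℝ) ≤ Real.exp (1 + ‖v‖) := by linarith [Real.add_one_le_exp (1 + ‖v‖)]
  rw [add_mul, one_mul, Real.exp_add]
  have := Real.exp_pos ((B + D) * (1 + ‖v‖))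
  nlinarith [abs_add_le (f t v) (g t v), hfB t ht v, hgD t ht v]

lemma mul (hf : Tame S f) (hg : Tame S g) : Tame S (fun t v => f t v * g t v) := by
  obtain ⟨B, hB, hfB⟩ := hf.bdd
  obtain ⟨D, hD, hgD⟩ := hg.bdd
  refine ⟨fun t ht => (hf.cont t ht).mul (hg.cont t ht), B + D, by positivity,
    fun t ht v => ?_⟩
  rw [add_mul, Real.exp_add, abs_mul]
  exact mul_le_mul (hfB t ht v) (hgD t ht v) (abs_nonneg _) (Real.exp_pos _).le

lemma const_mul (r : ℝ) (hf : Tame S f) : Tame S (fun t v => r * f t v) := (const S r).mul hf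

lemma sub (hf : Tame S f) (hg : Tame S g) : Tame S (fun t v => f t v - g t v) := by
  simpa [sub_eq_add_neg] using hf.add (hg.const_mul (-1))

lemma sum {ι : Type*} {s : Finset ι} {F : ι → ℝ → (I → ℝ) → ℝ} (h : ∀ i ∈ s, Tame S (F i)) :
    Tame S (fun t v => ∑ i ∈ s, F i t v) := by
  classical
  induction s using Finset.induction_on with
  | empty => simpa using const S 0
  | insert i s hi ih =>
    simp only [Finset.sum_insert hi]
    exact (h i (Finset.mem_insert_self _ _)).add
      (ih fun k hk => h k (Finset.mem_insert_of_mem hk))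

end Tame

namespace PosTame

variable {U W : ℝ → (I → ℝ) → ℝ}

lemma tame (h : PosTame S W) : Tame S W := by
  obtain ⟨B, hB, hb⟩ := h.bdd
  refine ⟨h.cont, B, hB, fun t ht v => ?_⟩
  rw [abs_of_pos (h.pos t ht v)]
  calc W t v = Real.exp (Real.log (W t v)) := (Real.exp_log (h.pos t ht v)).symm
    _ ≤ _ := Real.exp_le_exp.2 ((le_abs_self _).trans (hb t ht v))

lemma rpow (h : PosTame S W) (a : ℝ) : PosTame S (fun t v => W t v ^ a) := by
  obtain ⟨B, hB, hb⟩ := h.bdd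
  refine ⟨fun t ht v => Real.rpow_pos_of_pos (h.pos t ht v) a,
    fun t ht => (h.cont t ht).rpow_const fun v => Or.inl (h.pos t ht v).ne',
    |a| * B, by positivity, fun t ht v => ?_⟩
  rw [Real.log_rpow (h.pos t ht v), abs_mul, mul_assoc]
  exact mul_le_mul_of_nonneg_left (hb t ht v) (abs_nonneg a)

lemma mul (h : PosTame S W) (h' : PosTame S U) : PosTame S (fun t v => W t v * U t v) := by
  obtain ⟨B, hB, hb⟩ := h.bdd
  obtain ⟨D, hD, hd⟩ := h'.bdd
  refine ⟨fun t ht v => mul_pos (h.pos t ht v) (h'.pos t ht v),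
    fun t ht => (h.cont t ht).mul (h'.cont t ht), B + D, by positivity, fun t ht v => ?_⟩
  rw [Real.log_mul (h.pos t ht v).ne' (h'.pos t ht v).ne', add_mul]
  exact (abs_add_le _ _).trans (add_le_add (hb t ht v) (hd t ht v))

lemma inv (h : PosTame S W) : PosTame S (fun t v => (W t v)⁻¹) := by
  obtain ⟨B, hB, hb⟩ := h.bdd
  refine ⟨fun t ht v => inv_pos.2 (h.pos t ht v),
    fun t ht => (h.cont t ht).inv₀ fun v => (h.pos t ht v).ne', B, hB, fun t ht v => ?_⟩
  rw [Real.log_inv, abs_neg]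
  exact hb t ht v

lemma div (h : PosTame S W) (h' : PosTame S U) : PosTame S (fun t v => W t v / U t v) := by
  simpa only [div_eq_mul_inv] using h.mul h'.inv

lemma tame_div {f : ℝ → (I → ℝ) → ℝ} (hf : Tame S f) (h : PosTame S W) :
    Tame S (fun t v => f t v / W t v) := by
  simpa only [div_eq_mul_inv] using hf.mul h.inv.tame

lemma tame_log (h : PosTame S W) : Tame S (fun t v => Real.log (W t v)) := by
  obtain ⟨B, hB, hb⟩ := h.bdd
  refine ⟨fun t ht => (h.cont t ht).log fun v => (h.pos t ht v).ne', B, hB, fun t ht v => ?_⟩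
  exact (hb t ht v).trans (by linarith [Real.add_one_le_exp (B * (1 + ‖v‖))])

/-- The additive constant `D` is absorbed into the rate because `1 + ‖v‖ ≥ 1`. -/
lemma of_bounds {B D : ℝ} (hW : ∀ t ∈ S, Continuous (W t))
    (hlo : ∀ t ∈ S, ∀ v, Real.exp (-(B * (1 + ‖v‖) + D)) ≤ W t v)
    (hup : ∀ t ∈ S, ∀ v, W t v ≤ Real.exp (B * (1 + ‖v‖) + D)) : PosTame S W := by
  have hpos : ∀ t ∈ S, ∀ v, 0 < W t v := fun t ht v => (Real.exp_pos _).trans_le (hlo t ht v)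
  refine ⟨hpos, hW, |B| + |D|, by positivity, fun t ht v => ?_⟩
  have h1 := (Real.le_log_iff_exp_le (hpos t ht v)).2 (hlo t ht v)
  have h2 := (Real.log_le_iff_le_exp (hpos t ht v)).2 (hup t ht v)
  have h3 : B * (1 + ‖v‖) ≤ |B| * (1 + ‖v‖) := by gcongr; exact le_abs_self B
  have h4 : D ≤ |D| * (1 + ‖v‖) := by
    nlinarith [le_abs_self D, abs_nonneg D, norm_nonneg v]
  rw [abs_le, add_mul]
  constructor <;> linarith

/-- The upper bound comes from the growth of sums, the lower bound from any single positive summand,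
whence the nonemptiness. -/
lemma sum {ι : Type*} {s : Finset ι} (hs : s.Nonempty) {F : ι → ℝ → (I → ℝ) → ℝ}
    (h : ∀ i ∈ s, PosTame S (F i)) : PosTame S (fun t v => ∑ i ∈ s, F i t v) := by
  have ht := Tame.sum (s := s) (F := F) fun i hi => (h i hi).tame
  obtain ⟨B, hB, hb⟩ := ht.bdd
  obtain ⟨k, hk⟩ := hs
  obtain ⟨D, hD, hd⟩ := (h k hk).bdd
  refine of_bounds (B := B + D) (D := 0) ht.cont (fun t ht v => ?_) (fun t ht v => ?_)
  · have h1 : F k t v ≤ ∑ i ∈ s, F i t v :=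
      Finset.single_le_sum (f := fun i => F i t v) (fun i hi => ((h i hi).pos t ht v).le) hk
    refine le_trans ?_ h1
    rw [← Real.exp_log ((h k hk).pos t ht v)]
    refine Real.exp_le_exp.2 ?_
    have := (abs_le.1 (hd t ht v)).1
    nlinarith [norm_nonneg v]
  · refine (le_abs_self _).trans ((hb t ht v).trans (Real.exp_le_exp.2 ?_))
    nlinarith [norm_nonneg v]

lemma exp_coord (S : Set ℝ) (β : ℝ) (i : I) :
    PosTame S (fun _ (v : I → ℝ) => Real.exp (β * v i)) := by
  refine ⟨fun t _ v => Real.exp_pos _, fun t _ => by fun_prop, |β|, abs_nonneg _,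
    fun t _ v => ?_⟩
  rw [Real.log_exp, abs_mul]
  gcongr
  have := norm_le_pi_norm v i
  rw [Real.norm_eq_abs] at this
  linarith

end PosTame

end Tame

/-! ### Gaussian averages and their stability properties. -/

section Average

variable {I J : Type*} [Fintype J] {S : Set ℝ}

/-- The linear image of `z` with coefficients `a j i t`. -/
noncomputable def linImage (a : J → I → ℝ → ℝ) (t : ℝ) (z : J → ℝ) : I → ℝ :=
  fun i => ∑ j, a j i t * z j

/-- The average of `f t (v + X)` over the Gaussian vector `X = linImage a t z`. -/
noncomputable def avg (σ : J → NNReal) (a : J → I → ℝ → ℝ) (f : ℝ → (I → ℝ) → ℝ) (t : ℝ)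
    (v : I → ℝ) : ℝ :=
  ∫ z, f t (v + linImage a t z) ∂gaussPi σ

lemma continuous_linImage (a : J → I → ℝ → ℝ) (t : ℝ) : Continuous (linImage a t) := by
  unfold linImage; fun_prop

variable [Fintype I]

/-- Coefficients that are differentiable on an open set of times, bounded with their derivatives. -/
structure SmoothCoeff (S : Set ℝ) (a a' : J → I → ℝ → ℝ) : Prop where
  isOpen : IsOpen S
  hasDerivAt : ∀ j i, ∀ t ∈ S, HasDerivAt (a j i) (a' j i t) t
  bdd : ∃ K, 0 ≤ K ∧ ∀ j i, ∀ t ∈ S, |a j i t| ≤ K ∧ |a' j i t| ≤ K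

lemma norm_linImage_le {a : J → I → ℝ → ℝ} {t K : ℝ} (hK : 0 ≤ K) (h : ∀ j i, |a j i t| ≤ K)
    (z : J → ℝ) : ‖linImage a t z‖ ≤ K * ∑ j, |z j| := by
  have hs : 0 ≤ ∑ j, |z j| := Finset.sum_nonneg fun j _ => abs_nonneg (z j)
  refine (pi_norm_le_iff_of_nonneg (by positivity)).2 fun i => ?_
  unfold linImage
  rw [Real.norm_eq_abs, Finset.mul_sum]
  refine (Finset.abs_sum_le_sum_abs _ _).trans (Finset.sum_le_sum fun j _ => ?_)
  rw [abs_mul]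
  exact mul_le_mul_of_nonneg_right (h j i) (abs_nonneg _)

namespace SmoothCoeff

variable {a a' : J → I → ℝ → ℝ} {f : ℝ → (I → ℝ) → ℝ}

/-- Splitting the bound into a factor in `v` and an integrable factor in `z`, with one rate for all
times, provides the dominating functions used below. -/
lemma growth (ha : SmoothCoeff S a a') (hf : Tame S f) :
    ∃ B, 0 ≤ B ∧ ∀ t ∈ S, ∀ v z, |f t (v + linImage a t z)|
      ≤ Real.exp (B * (1 + ‖v‖)) * Real.exp (B * ∑ j, |z j|) := by
  obtain ⟨B, hB, hb⟩ := hf.bdd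
  obtain ⟨K, hK, hk⟩ := ha.bdd
  refine ⟨B * (1 + K), by positivity, fun t ht v z => (hb t ht _).trans ?_⟩
  rw [← Real.exp_add]
  refine Real.exp_le_exp.2 ?_
  have h1 := norm_linImage_le hK (fun j i => (hk j i t ht).1) z
  have h2 := norm_add_le v (linImage a t z)
  have hs : 0 ≤ ∑ j, |z j| := Finset.sum_nonneg fun j _ => abs_nonneg (z j)
  have h3 : 1 + ‖v + linImage a t z‖ ≤ (1 + K) * (1 + ‖v‖) + (1 + K) * ∑ j, |z j| := by
    nlinarith [norm_nonneg v]
  calc B * (1 + ‖v + linImage a t z‖)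
      ≤ B * ((1 + K) * (1 + ‖v‖) + (1 + K) * ∑ j, |z j|) := by gcongr
    _ = _ := by ring

lemma continuous_comp (hf : Tame S f) {t : ℝ} (ht : t ∈ S) (v : I → ℝ) :
    Continuous fun z => f t (v + linImage a t z) :=
  (hf.cont t ht).comp (continuous_const.add (continuous_linImage a t))

lemma integrable (ha : SmoothCoeff S a a') (σ : J → NNReal) (hf : Tame S f) {t : ℝ} (ht : t ∈ S)
    (v : I → ℝ) : Integrable (fun z => f t (v + linImage a t z)) (gaussPi σ) := by
  obtain ⟨B, hB, hb⟩ := ha.growth hf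
  exact ((integrable_exp_sum_abs σ B).const_mul _).mono'
    (continuous_comp hf ht v).aestronglyMeasurable (ae_of_all _ fun z => hb t ht v z)

lemma tame_avg (ha : SmoothCoeff S a a') (σ : J → NNReal) (hf : Tame S f) :
    Tame S (avg σ a f) := by
  obtain ⟨B, hB, hb⟩ := ha.growth hf
  refine ⟨fun t ht => continuous_iff_continuousAt.2 fun v => ?_, ?_⟩
  · refine continuousAt_of_dominated
      (bound := fun z => Real.exp (B * (1 + (‖v‖ + 1))) * Real.exp (B * ∑ j, |z j|))
      (Eventually.of_forall fun v => (continuous_comp hf ht v).aestronglyMeasurable)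
      ?_ ((integrable_exp_sum_abs σ B).const_mul _) (ae_of_all _ fun z => ?_)
    · filter_upwards [Metric.ball_mem_nhds v one_pos] with w hw
      refine ae_of_all _ fun z => (hb t ht w z).trans ?_
      have : ‖w‖ ≤ ‖v‖ + 1 := by
        have h1 := norm_sub_norm_le w v
        rw [mem_ball_iff_norm] at hw
        linarith
      gcongr
    · exact ((hf.cont t ht).comp (continuous_id.add continuous_const)).continuousAt
  · set M := ∫ z, Real.exp (B * ∑ j, |z j|) ∂gaussPi σ with hM
    have hM0 : 0 ≤ M := integral_nonneg fun z => (Real.exp_pos _).le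
    refine ⟨B + M, by positivity, fun t ht v => ?_⟩
    have h1 : |avg σ a f t v| ≤ Real.exp (B * (1 + ‖v‖)) * M := by
      rw [hM, ← integral_const_mul]
      exact norm_integral_le_of_norm_le (f := fun z => f t (v + linImage a t z))
        ((integrable_exp_sum_abs σ B).const_mul _) (ae_of_all _ fun z => hb t ht v z)
    refine h1.trans ?_
    rw [add_mul, Real.exp_add]
    gcongr
    -- The constant `M` is at most `exp (M (1 + ‖v‖))`.
    nlinarith [Real.add_one_le_exp (M * (1 + ‖v‖)), norm_nonneg v]

/-- Growth of `f⁻¹` is a lower bound for `f`, decaying exponentially in `v` and `z` separately;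
integrating it in `z` leaves a positive constant. -/
lemma posTame_avg (ha : SmoothCoeff S a a') (σ : J → NNReal) (hf : PosTame S f) :
    PosTame S (avg σ a f) := by
  obtain ⟨B, hB, hb⟩ := ha.growth hf.tame
  obtain ⟨D, hD, hd⟩ := ha.growth hf.inv.tame
  set M := ∫ z, Real.exp (B * ∑ j, |z j|) ∂gaussPi σ with hM
  set m := ∫ z, Real.exp (-D * ∑ j, |z j|) ∂gaussPi σ with hm
  have hM0 : 0 < M := integral_exp_pos (integrable_exp_sum_abs σ B)
  have hm0 : 0 < m := integral_exp_pos (integrable_exp_sum_abs σ (-D))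
  refine PosTame.of_bounds (B := B + D) (D := |Real.log M| + |Real.log m|)
    (ha.tame_avg σ hf.tame).cont (fun t ht v => ?_) (fun t ht v => ?_)
  · have h1 : Real.exp (-(D * (1 + ‖v‖))) * m ≤ avg σ a f t v := by
      rw [hm, ← integral_const_mul]
      refine integral_mono ((integrable_exp_sum_abs σ (-D)).const_mul _)
        (ha.integrable σ hf.tame ht v) fun z => ?_
      have h2 := hd t ht v z
      have h3 := hf.pos t ht (v + linImage a t z)
      rw [abs_of_pos (inv_pos.2 h3), ← Real.exp_add] at h2
      have h4 := inv_anti₀ (inv_pos.2 h3) h2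
      rw [inv_inv, ← Real.exp_neg, neg_add, Real.exp_add] at h4
      simpa only [neg_mul] using h4
    refine le_trans ?_ h1
    rw [← Real.exp_log hm0, ← Real.exp_add]
    refine Real.exp_le_exp.2 ?_
    simp only [Real.exp_log hm0]
    nlinarith [abs_nonneg (Real.log M), neg_abs_le (Real.log m), norm_nonneg v]
  · have h1 : avg σ a f t v ≤ Real.exp (B * (1 + ‖v‖)) * M := by
      rw [hM, ← integral_const_mul]
      exact integral_mono (ha.integrable σ hf.tame ht v)
        ((integrable_exp_sum_abs σ B).const_mul _)
        fun z => (le_abs_self _).trans (hb t ht v z)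
    refine h1.trans ?_
    rw [← Real.exp_log hM0, ← Real.exp_add]
    refine Real.exp_le_exp.2 ?_
    simp only [Real.exp_log hM0]
    nlinarith [le_abs_self (Real.log M), abs_nonneg (Real.log m), norm_nonneg v]

end SmoothCoeff

end Average

/-! ### Second-order jets and the heat equation. -/

section Jets

variable {I J : Type*} [Fintype J] {S : Set ℝ}

lemma linImage_update [DecidableEq J] (a : J → I → ℝ → ℝ) (t : ℝ) (z : J → ℝ) (j : J) (u : ℝ) :
    HasDerivAt (fun u => linImage a t (Function.update z j u)) (fun i => a j i t) u := by
  refine hasDerivAt_pi.2 fun i => ?_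
  have : HasDerivAt (fun u => ∑ k, a k i t * Function.update z j u k)
      (∑ k, a k i t * (Pi.single j (1 : ℝ) : J → ℝ) k) u :=
    HasDerivAt.fun_sum fun k _ => ((hasDerivAt_pi.1 (hasDerivAt_update z j u)) k).const_mul _
  refine this.congr_deriv ?_
  simp [Pi.single_apply]

variable [Fintype I]

/-- The linear form on `ℝ^I` with coefficients `d`. -/
noncomputable def spaceForm (d : I → ℝ) : (I → ℝ) →L[ℝ] ℝ :=
  ∑ i, d i • ContinuousLinearMap.proj i

/-- The linear form on `ℝ × ℝ^I` with coefficients `h` and `d`. -/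
noncomputable def timeSpaceForm (h : ℝ) (d : I → ℝ) : ℝ × (I → ℝ) →L[ℝ] ℝ :=
  h • ContinuousLinearMap.fst ℝ ℝ (I → ℝ)
    + ∑ i, d i • (ContinuousLinearMap.proj i).comp (ContinuousLinearMap.snd ℝ ℝ (I → ℝ))

@[simp] lemma spaceForm_apply (d w : I → ℝ) : spaceForm d w = ∑ i, d i * w i := by
  simp [spaceForm]

@[simp] lemma timeSpaceForm_apply (h : ℝ) (d : I → ℝ) (w : ℝ × (I → ℝ)) :
    timeSpaceForm h d w = h * w.1 + ∑ i, d i * w.2 i := by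
  simp [timeSpaceForm]

lemma norm_spaceForm_le (d : I → ℝ) : ‖spaceForm d‖ ≤ ∑ i, |d i| := by
  refine ContinuousLinearMap.opNorm_le_bound _ (Finset.sum_nonneg fun i _ => abs_nonneg _)
    fun w => ?_
  rw [spaceForm_apply, Finset.sum_mul, Real.norm_eq_abs]
  refine (Finset.abs_sum_le_sum_abs _ _).trans (Finset.sum_le_sum fun i _ => ?_)
  rw [abs_mul]
  exact mul_le_mul_of_nonneg_left (norm_le_pi_norm w i) (abs_nonneg _)

lemma norm_timeSpaceForm_le (h : ℝ) (d : I → ℝ) : ‖timeSpaceForm h d‖ ≤ |h| + ∑ i, |d i| := by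
  refine ContinuousLinearMap.opNorm_le_bound _
    (add_nonneg (abs_nonneg _) (Finset.sum_nonneg fun i _ => abs_nonneg _)) fun w => ?_
  rw [timeSpaceForm_apply, add_mul, Finset.sum_mul, Real.norm_eq_abs]
  refine (abs_add_le _ _).trans (add_le_add ?_ ((Finset.abs_sum_le_sum_abs _ _).trans
    (Finset.sum_le_sum fun i _ => ?_))) <;> rw [abs_mul]
  · exact mul_le_mul_of_nonneg_left (norm_fst_le w) (abs_nonneg _)
  · exact mul_le_mul_of_nonneg_left ((norm_le_pi_norm w.2 i).trans (norm_snd_le w)) (abs_nonneg _)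

lemma integral_spaceForm {Ω : Type*} [MeasurableSpace Ω] {μ : Measure Ω} {D : Ω → I → ℝ}
    (hD : ∀ i, Integrable (fun z => D z i) μ) :
    ∫ z, spaceForm (D z) ∂μ = spaceForm fun i => ∫ z, D z i ∂μ := by
  unfold spaceForm
  rw [integral_finsetSum _ fun i _ => (hD i).smul_const _]
  exact Finset.sum_congr rfl fun i _ => integral_smul_const _ _

lemma integral_timeSpaceForm {Ω : Type*} [MeasurableSpace Ω] {μ : Measure Ω} {H : Ω → ℝ}
    {D : Ω → I → ℝ} (hH : Integrable H μ) (hD : ∀ i, Integrable (fun z => D z i) μ) :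
    ∫ z, timeSpaceForm (H z) (D z) ∂μ
      = timeSpaceForm (∫ z, H z ∂μ) fun i => ∫ z, D z i ∂μ := by
  unfold timeSpaceForm
  rw [integral_add (hH.smul_const _) (integrable_finsetSum _ fun i _ => (hD i).smul_const _),
    integral_finsetSum _ fun i _ => (hD i).smul_const _, integral_smul_const]
  exact congrArg _ (Finset.sum_congr rfl fun i _ => integral_smul_const _ _)

/-- `h` is the time derivative of `g`, `d` its gradient and `q` its Hessian in space,
all of them of exponential growth. -/
structure IsJet (S : Set ℝ) (g h : ℝ → (I → ℝ) → ℝ) (d : I → ℝ → (I → ℝ) → ℝ)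
    (q : I → I → ℝ → (I → ℝ) → ℝ) : Prop where
  tame : Tame S g
  tame_time : Tame S h
  tame_grad : ∀ i, Tame S (d i)
  tame_hess : ∀ i k, Tame S (q i k)
  hasFDerivAt : ∀ t ∈ S, ∀ v, HasFDerivAt (fun w : ℝ × (I → ℝ) => g w.1 w.2)
    (timeSpaceForm (h t v) fun i => d i t v) (t, v)
  hasFDerivAt_grad : ∀ t ∈ S, ∀ v i, HasFDerivAt (d i t) (spaceForm fun k => q i k t v) v

/-- A bound, uniform on unit balls, for the translates of a tame function. -/
lemma SmoothCoeff.growth_ball {a a' : J → I → ℝ → ℝ} {f : ℝ → (I → ℝ) → ℝ}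
    (ha : SmoothCoeff S a a') (hf : Tame S f) (v₀ : I → ℝ) :
    ∃ M B, 0 ≤ M ∧ 0 ≤ B ∧ ∀ t ∈ S, ∀ v ∈ Metric.ball v₀ 1, ∀ z,
      |f t (v + linImage a t z)| ≤ M * Real.exp (B * ∑ j, |z j|) := by
  obtain ⟨B, hB, hb⟩ := ha.growth hf
  refine ⟨Real.exp (B * (1 + (‖v₀‖ + 1))), B, (Real.exp_pos _).le, hB, fun t ht v hv z =>
    (hb t ht v z).trans ?_⟩
  have : ‖v‖ ≤ ‖v₀‖ + 1 := by
    have h1 := norm_sub_norm_le v v₀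
    rw [mem_ball_iff_norm] at hv
    linarith
  gcongr

/-- A common bound, uniform on unit balls, for the translates of finitely many tame functions. -/
lemma SmoothCoeff.growth_ball_sum {a a' : J → I → ℝ → ℝ} {ι : Type*} [Fintype ι]
    {f : ι → ℝ → (I → ℝ) → ℝ} (ha : SmoothCoeff S a a') (hf : ∀ i, Tame S (f i)) (v₀ : I → ℝ)
    (σ : J → NNReal) (e : ℝ) :
    ∃ b : (J → ℝ) → ℝ, Integrable (fun z => b z * Real.exp (e * ∑ j, |z j|)) (gaussPi σ) ∧
      ∀ t ∈ S, ∀ v ∈ Metric.ball v₀ 1, ∀ z, ∑ i, |f i t (v + linImage a t z)| ≤ b z := by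
  choose M B hM hB hb using fun i => ha.growth_ball (hf i) v₀
  refine ⟨fun z => ∑ i, M i * Real.exp (B i * ∑ j, |z j|), ?_, fun t ht v hv z =>
    Finset.sum_le_sum fun i _ => hb i t ht v hv z⟩
  simp only [Finset.sum_mul, mul_assoc, ← Real.exp_add, ← add_mul]
  exact integrable_finsetSum _ fun i _ => (integrable_exp_sum_abs σ _).const_mul _

/-- Dominated differentiation under the integral: translation in `v` commutes with averaging, so the
gradient is averaged coordinatewise. -/
lemma SmoothCoeff.hasFDerivAt_avg_space {a a' : J → I → ℝ → ℝ} {f : ℝ → (I → ℝ) → ℝ}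
    {d : I → ℝ → (I → ℝ) → ℝ} (ha : SmoothCoeff S a a') (σ : J → NNReal) (hf : Tame S f)
    (hd : ∀ i, Tame S (d i)) {t : ℝ} (ht : t ∈ S)
    (hfd : ∀ v, HasFDerivAt (f t) (spaceForm fun i => d i t v) v) (v : I → ℝ) :
    HasFDerivAt (avg σ a f t) (spaceForm fun i => avg σ a (d i) t v) v := by
  obtain ⟨b, hbi, hb⟩ := ha.growth_ball_sum hd v σ 0
  simp only [zero_mul, Real.exp_zero, mul_one] at hbi
  have hcd : ∀ i, Continuous fun z => d i t (v + linImage a t z) :=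
    fun i => continuous_comp (hd i) ht v
  have := hasFDerivAt_integral_of_dominated_of_fderiv_le (μ := gaussPi σ)
    (F := fun v z => f t (v + linImage a t z))
    (F' := fun v z => spaceForm fun i => d i t (v + linImage a t z)) (bound := b)
    (Metric.ball_mem_nhds v one_pos)
    (Eventually.of_forall fun v => (continuous_comp hf ht v).aestronglyMeasurable)
    (ha.integrable σ hf ht v)
    (Continuous.aestronglyMeasurable (by
      unfold spaceForm
      exact continuous_finsetSum _ fun i _ => (hcd i).smul continuous_const))
    (ae_of_all _ fun z w hw => (norm_spaceForm_le _).trans (hb t ht w hw z)) hbi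
    (ae_of_all _ fun z w _ => ((hfd _).comp w ((hasFDerivAt_id w).add_const _)).congr_fderiv
      (ContinuousLinearMap.comp_id _))
  rw [integral_spaceForm fun i => ha.integrable σ (hd i) ht v] at this
  exact this

/-- Integration by parts for averages. -/
lemma SmoothCoeff.integral_coord_mul {a a' : J → I → ℝ → ℝ} {f : ℝ → (I → ℝ) → ℝ}
    {d : I → ℝ → (I → ℝ) → ℝ} (ha : SmoothCoeff S a a') (σ : J → NNReal) (hf : Tame S f)
    (hd : ∀ i, Tame S (d i)) {t : ℝ} (ht : t ∈ S)
    (hfd : ∀ v, HasFDerivAt (f t) (spaceForm fun i => d i t v) v) (v : I → ℝ) (j : J) :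
    ∫ z, z j * f t (v + linImage a t z) ∂gaussPi σ
      = ∑ k, σ j * a j k t * avg σ a (d k) t v := by
  classical
  -- This is the derivative of `f` in the direction in which the coordinate `z j` moves the field.
  have hd' : Tame S fun t v => ∑ k, a j k t * d k t v := by
    obtain ⟨K, -, hk⟩ := ha.bdd
    exact Tame.sum fun k _ => (Tame.of_time fun t ht => (hk j k t ht).1).mul (hd k)
  obtain ⟨M, B, hM, hB, hb⟩ := ha.growth_ball hf v
  obtain ⟨M', B', hM', hB', hb'⟩ := ha.growth_ball hd' v
  have hle : ∀ (z : J → ℝ) (N D : ℝ), 0 ≤ N → N ≤ M + M' → D ≤ B + B' →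
      N * Real.exp (D * ∑ j, |z j|) ≤ (M + M') * Real.exp ((B + B') * ∑ j, |z j|) := by
    intro z N D hN h1 h2
    have : 0 ≤ ∑ j, |z j| := Finset.sum_nonneg fun j _ => abs_nonneg (z j)
    gcongr
  have hv := Metric.mem_ball_self (x := v) one_pos
  rw [integral_coord_mul_gaussPi σ j (f := fun z => f t (v + linImage a t z))
    (f' := fun z => ∑ k, a j k t * d k t (v + linImage a t z)) (M := M + M') (B := B + B')
    (by positivity) (fun z u => ?_) (continuous_comp hf ht v) (continuous_comp hd' ht v)
    (fun z => (hb t ht v hv z).trans (hle z _ _ hM (by linarith) (by linarith)))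
    (fun z => (hb' t ht v hv z).trans (hle z _ _ hM' (by linarith) (by linarith)))]
  · rw [integral_finsetSum _ fun k _ => (ha.integrable σ (hd k) ht v).const_mul _,
      Finset.mul_sum]
    refine Finset.sum_congr rfl fun k _ => ?_
    rw [integral_const_mul, avg]
    ring
  · have h1 := (linImage_update a t z j u).const_add v
    refine ((hfd _).comp_hasDerivAt u h1).congr_deriv ?_
    rw [spaceForm_apply]
    exact Finset.sum_congr rfl fun k _ => mul_comm _ _

/-- The joint derivative in `(t, v)` is needed because time enters both through `g` and through the
translation. -/
lemma hasFDerivAt_linImage {a a' : J → I → ℝ → ℝ} (ha : SmoothCoeff S a a') {t : ℝ} (ht : t ∈ S)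
    (v : I → ℝ) (z : J → ℝ) :
    HasFDerivAt (fun w : ℝ × (I → ℝ) => (w.1, w.2 + linImage a w.1 z))
      ((ContinuousLinearMap.fst ℝ ℝ (I → ℝ)).prod (ContinuousLinearMap.snd ℝ ℝ (I → ℝ)
        + (ContinuousLinearMap.fst ℝ ℝ (I → ℝ)).smulRight (linImage a' t z))) (t, v) := by
  have h1 : HasDerivAt (fun τ => linImage a τ z) (linImage a' t z) t :=
    hasDerivAt_pi.2 fun i => HasDerivAt.fun_sum fun j _ => (ha.hasDerivAt j i t ht).mul_const _
  have h2 : HasFDerivAt (fun w : ℝ × (I → ℝ) => linImage a w.1 z)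
      ((ContinuousLinearMap.fst ℝ ℝ (I → ℝ)).smulRight (linImage a' t z)) (t, v) := by
    refine (h1.hasFDerivAt.comp (t, v)
      (hasFDerivAt_fst (𝕜 := ℝ) (E := ℝ) (F := I → ℝ) (p := (t, v)))).congr_fderiv ?_
    ext <;> simp
  exact hasFDerivAt_fst.prodMk (hasFDerivAt_snd.add h2)

/-- Averaging preserves jets: the heat equation. -/
theorem IsJet.avg {a a' : J → I → ℝ → ℝ} {g h : ℝ → (I → ℝ) → ℝ} {d : I → ℝ → (I → ℝ) → ℝ}
    {q : I → I → ℝ → (I → ℝ) → ℝ} (hg : IsJet S g h d q) (ha : SmoothCoeff S a a')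
    (σ : J → NNReal) :
    IsJet S (avg σ a g)
      (fun t v => avg σ a h t v
        + ∑ i, ∑ k, (∑ j, σ j * a' j i t * a j k t) * avg σ a (q i k) t v)
      (fun i => avg σ a (d i)) (fun i k => avg σ a (q i k)) := by
  obtain ⟨K, hK, hk⟩ := ha.bdd
  refine ⟨ha.tame_avg σ hg.tame, (ha.tame_avg σ hg.tame_time).add
    (Tame.sum fun i _ => Tame.sum fun k _ => (Tame.sum fun j _ =>
      ((Tame.const S _).mul (Tame.of_time fun t ht => (hk j i t ht).2)).mul
        (Tame.of_time fun t ht => (hk j k t ht).1)).mul (ha.tame_avg σ (hg.tame_hess i k))),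
    fun i => ha.tame_avg σ (hg.tame_grad i), fun i k => ha.tame_avg σ (hg.tame_hess i k),
    fun t ht v => ?_, fun t ht v i => ha.hasFDerivAt_avg_space σ (hg.tame_grad i)
      (hg.tame_hess i) ht (fun v => hg.hasFDerivAt_grad t ht v i) v⟩
  -- The weight `e = 1` leaves room for an extra `exp (∑ |z j|)`, which dominates the linear factor
  -- `linImage a' t z` produced by the time derivative.
  obtain ⟨b₁, hbi₁, hb₁⟩ := ha.growth_ball_sum (fun _ : Unit => hg.tame_time) v σ 1
  obtain ⟨b₂, hbi₂, hb₂⟩ := ha.growth_ball_sum hg.tame_grad v σ 1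
  simp only [one_mul, Finset.univ_unique, Finset.sum_singleton] at hbi₁ hb₁ hbi₂
  have hcd : ∀ i, Continuous fun z => d i t (v + linImage a t z) :=
    fun i => SmoothCoeff.continuous_comp (hg.tame_grad i) ht v
  have hct : Continuous fun z => h t (v + linImage a t z) := SmoothCoeff.continuous_comp hg.tame_time ht v
  have hca : Continuous fun z => linImage a' t z := continuous_linImage a' t
  have hci : ∀ i, Continuous fun z => linImage a' t z i := fun i => (continuous_apply i).comp hca
  have hS : S ×ˢ Metric.ball v 1 ∈ 𝓝 (t, v) :=
    prod_mem_nhds (ha.isOpen.mem_nhds ht) (Metric.ball_mem_nhds v one_pos)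
  have hzi : ∀ i, Integrable (fun z => d i t (v + linImage a t z) * linImage a' t z i)
      (gaussPi σ) := by
    intro i
    refine (hbi₂.const_mul K).mono' ((hcd i).mul (hci i)).aestronglyMeasurable
      (ae_of_all _ fun z => ?_)
    have h1 := (Finset.single_le_sum (f := fun i => |d i t (v + linImage a t z)|)
      (fun i _ => abs_nonneg _) (Finset.mem_univ i)).trans
        (hb₂ t ht v (Metric.mem_ball_self one_pos) z)
    have h2 : |linImage a' t z i| ≤ K * Real.exp (∑ j, |z j|) := by
      have h3 := (norm_le_pi_norm (linImage a' t z) i).trans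
        (norm_linImage_le hK (fun j i => (hk j i t ht).2) z)
      refine h3.trans ?_
      gcongr
      linarith [Real.add_one_le_exp (∑ j, |z j|)]
    rw [Real.norm_eq_abs, abs_mul]
    calc _ ≤ b₂ z * (K * Real.exp (∑ j, |z j|)) :=
          mul_le_mul h1 h2 (abs_nonneg _) ((abs_nonneg _).trans h1)
      _ = _ := by ring
  have hti : Integrable (fun z => h t (v + linImage a t z)) (gaussPi σ) :=
    ha.integrable σ hg.tame_time ht v
  have key := hasFDerivAt_integral_of_dominated_of_fderiv_le (μ := gaussPi σ)
    (F := fun (w : ℝ × (I → ℝ)) z => g w.1 (w.2 + linImage a w.1 z))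
    (F' := fun (w : ℝ × (I → ℝ)) z => timeSpaceForm
      (h w.1 (w.2 + linImage a w.1 z)
        + ∑ i, d i w.1 (w.2 + linImage a w.1 z) * linImage a' w.1 z i)
      fun i => d i w.1 (w.2 + linImage a w.1 z))
    (bound := fun z => b₁ z * Real.exp (∑ j, |z j|)
      + (K + 1) * (b₂ z * Real.exp (∑ j, |z j|))) hS
    (by
      filter_upwards [hS] with w hw
      exact (SmoothCoeff.continuous_comp hg.tame hw.1 w.2).aestronglyMeasurable)
    (ha.integrable σ hg.tame ht v)
    (Continuous.aestronglyMeasurable (by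
      unfold timeSpaceForm
      exact ((hct.add (continuous_finsetSum _ fun i _ => (hcd i).mul (hci i))).smul
        continuous_const).add (continuous_finsetSum _ fun i _ => (hcd i).smul continuous_const)))
    (ae_of_all _ fun z w hw => ?_) (hbi₁.add (hbi₂.const_mul _))
    (ae_of_all _ fun z w hw => ?_)
  · rw [integral_timeSpaceForm
      (H := fun z => h t (v + linImage a t z)
        + ∑ i, d i t (v + linImage a t z) * linImage a' t z i)
      (hti.add (integrable_finsetSum Finset.univ fun i _ => hzi i))
      fun i => ha.integrable σ (hg.tame_grad i) ht v] at key
    refine key.congr_fderiv ?_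
    congr 1
    rw [integral_add hti (integrable_finsetSum _ fun i _ => hzi i),
      integral_finsetSum _ fun i _ => hzi i]
    refine congrArg₂ (· + ·) rfl (Finset.sum_congr rfl fun i _ => ?_)
    have hzj : ∀ j, Integrable (fun z => z j * d i t (v + linImage a t z)) (gaussPi σ) := by
      intro j
      refine hbi₂.mono' ((continuous_apply j).mul (hcd i)).aestronglyMeasurable
        (ae_of_all _ fun z => ?_)
      have h1 := (Finset.single_le_sum (f := fun i => |d i t (v + linImage a t z)|)
        (fun i _ => abs_nonneg _) (Finset.mem_univ i)).trans
          (hb₂ t ht v (Metric.mem_ball_self one_pos) z)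
      have h2 := Finset.single_le_sum (f := fun j => |z j|)
        (fun i _ => abs_nonneg _) (Finset.mem_univ j)
      rw [Real.norm_eq_abs, abs_mul, mul_comm]
      refine mul_le_mul h1 ?_ (abs_nonneg _) ((abs_nonneg _).trans h1)
      refine h2.trans ?_
      linarith [Real.add_one_le_exp (∑ j, |z j|)]
    -- Expanding `X_t'` in the coordinates `z j` makes the integration by parts applicable; each `z
    -- j` trades for `σ j` times the `j`-th directional derivative of `d i`.
    have h3 : ∀ z, d i t (v + linImage a t z) * linImage a' t z i
        = ∑ j, a' j i t * (z j * d i t (v + linImage a t z)) := by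
      intro z
      rw [linImage, Finset.mul_sum]
      exact Finset.sum_congr rfl fun j _ => by ring
    simp only [h3]
    rw [integral_finsetSum _ fun j _ => (hzj j).const_mul _]
    simp only [integral_const_mul, ha.integral_coord_mul σ (hg.tame_grad i) (hg.tame_hess i) ht
      (fun v => hg.hasFDerivAt_grad t ht v i) v, Finset.mul_sum, Finset.sum_mul]
    rw [Finset.sum_comm]
    exact Finset.sum_congr rfl fun k _ => Finset.sum_congr rfl fun j _ => by ring
  · have e1 := hb₁ w.1 hw.1 w.2 hw.2 z
    have e2 := hb₂ w.1 hw.1 w.2 hw.2 z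
    have hs : 0 ≤ ∑ j, |z j| := Finset.sum_nonneg fun j _ => abs_nonneg (z j)
    have e3 : ∀ i, |linImage a' w.1 z i| ≤ K * Real.exp (∑ j, |z j|) := by
      intro i
      refine ((norm_le_pi_norm (linImage a' w.1 z) i).trans
        (norm_linImage_le hK (fun j i => (hk j i w.1 hw.1).2) z)).trans ?_
      gcongr
      linarith [Real.add_one_le_exp (∑ j, |z j|)]
    have e4 : |∑ i, d i w.1 (w.2 + linImage a w.1 z) * linImage a' w.1 z i|
        ≤ b₂ z * (K * Real.exp (∑ j, |z j|)) := by
      refine (Finset.abs_sum_le_sum_abs _ _).trans ?_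
      refine le_trans ?_ (mul_le_mul_of_nonneg_right e2
        (mul_nonneg hK (Real.exp_pos (∑ j, |z j|)).le))
      rw [Finset.sum_mul]
      refine Finset.sum_le_sum fun i _ => ?_
      rw [abs_mul]
      exact mul_le_mul_of_nonneg_left (e3 i) (abs_nonneg _)
    have e5 : 1 ≤ Real.exp (∑ j, |z j|) := Real.one_le_exp hs
    have e6 : 0 ≤ b₁ z := (abs_nonneg _).trans e1
    have e7 : 0 ≤ b₂ z := (Finset.sum_nonneg fun i _ => abs_nonneg _).trans e2
    refine (norm_timeSpaceForm_le _ _).trans ?_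
    refine (add_le_add (abs_add_le _ _) le_rfl).trans ?_
    nlinarith [mul_le_mul_of_nonneg_left e5 e6, mul_le_mul_of_nonneg_left e5 e7]
  · have h1 := hg.hasFDerivAt w.1 hw.1 (w.2 + linImage a w.1 z)
    have h2 := hasFDerivAt_linImage ha hw.1 w.2 z
    refine (HasFDerivAt.comp (f := fun w : ℝ × (I → ℝ) => (w.1, w.2 + linImage a w.1 z))
      (g := fun w : ℝ × (I → ℝ) => g w.1 w.2) (w.1, w.2) h1 h2).congr_fderiv ?_
    refine ContinuousLinearMap.ext fun u => ?_
    simp only [ContinuousLinearMap.comp_apply, ContinuousLinearMap.prod_apply,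
      add_apply, ContinuousLinearMap.smulRight_apply, timeSpaceForm_apply,
      ContinuousLinearMap.coe_fst', ContinuousLinearMap.coe_snd', Pi.add_apply, Pi.smul_apply,
      smul_eq_mul, mul_add, Finset.sum_add_distrib, add_mul, Finset.sum_mul]
    rw [add_assoc, add_comm (∑ i, _ * u.2 i)]
    refine congrArg₂ (· + ·) rfl (congrArg₂ (· + ·) (Finset.sum_congr rfl fun i _ => ?_) rfl)
    ring

end Jets

/-! ### Jets normalized by a positive function, powers and reweighting. -/

section LogJets

variable {I J : Type*} [Fintype I] [Fintype J] {S : Set ℝ}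

/-- `W` is a positive function with time derivative `c W h`, gradient `c W d` and
Hessian `c W q`, all of exponential growth. -/
structure IsLogJet (S : Set ℝ) (c : ℝ) (W h : ℝ → (I → ℝ) → ℝ) (d : I → ℝ → (I → ℝ) → ℝ)
    (q : I → I → ℝ → (I → ℝ) → ℝ) : Prop where
  posTame : PosTame S W
  tame_time : Tame S h
  tame_grad : ∀ i, Tame S (d i)
  tame_hess : ∀ i k, Tame S (q i k)
  hasFDerivAt : ∀ t ∈ S, ∀ v, HasFDerivAt (fun w : ℝ × (I → ℝ) => W w.1 w.2)
    (timeSpaceForm (c * W t v * h t v) fun i => c * W t v * d i t v) (t, v)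
  hasFDerivAt_grad : ∀ t ∈ S, ∀ v i, HasFDerivAt (fun v => W t v * d i t v)
    (spaceForm fun k => W t v * q i k t v) v

lemma Tame.congr {f g : ℝ → (I → ℝ) → ℝ} (hf : Tame S f) (h : ∀ t ∈ S, ∀ v, g t v = f t v) :
    Tame S g := by
  obtain ⟨B, hB, hb⟩ := hf.bdd
  refine ⟨fun t ht => ?_, B, hB, fun t ht v => by rw [h t ht]; exact hb t ht v⟩
  rw [show g t = f t from funext (h t ht)]
  exact hf.cont t ht

namespace IsLogJet

variable {c : ℝ} {W h : ℝ → (I → ℝ) → ℝ} {d : I → ℝ → (I → ℝ) → ℝ}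
  {q : I → I → ℝ → (I → ℝ) → ℝ}

lemma congr_time (hW : IsLogJet S c W h d q) {h' : ℝ → (I → ℝ) → ℝ}
    {d' : I → ℝ → (I → ℝ) → ℝ} (hh : ∀ t ∈ S, ∀ v, h' t v = h t v)
    (hd : ∀ i, ∀ t ∈ S, ∀ v, d' i t v = d i t v) :
    IsLogJet S c W h' d' q := by
  refine ⟨hW.posTame, hW.tame_time.congr hh, fun i => (hW.tame_grad i).congr (hd i),
    hW.tame_hess, fun t ht v => ?_, fun t ht v i => ?_⟩
  · simp only [hh t ht, hd _ t ht]
    exact hW.hasFDerivAt t ht v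
  · simp only [hd _ t ht]
    exact hW.hasFDerivAt_grad t ht v i

lemma hasFDerivAt_space (hW : IsLogJet S c W h d q) {t : ℝ} (ht : t ∈ S) (v : I → ℝ) :
    HasFDerivAt (W t) (spaceForm fun i => c * W t v * d i t v) v := by
  refine ((hW.hasFDerivAt t ht v).comp v (hasFDerivAt_prodMk_right t v)).congr_fderiv ?_
  refine ContinuousLinearMap.ext fun w => ?_
  simp

/-- The new function divided out by its own exponent `c'` has the same normalized logarithmic
derivatives. Only the Hessian datum moves: `∂_k d_i = q_ik - c d_i d_k` and differentiating the
power contributes `c' d_i d_k`. -/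
lemma rpow (hW : IsLogJet S c W h d q) (hc : c ≠ 0) (c' : ℝ) :
    IsLogJet S c' (fun t v => W t v ^ (c' / c)) h d
      (fun i k t v => q i k t v - (c - c') * (d i t v * d k t v)) := by
  refine ⟨hW.posTame.rpow _, hW.tame_time, hW.tame_grad, fun i k => (hW.tame_hess i k).sub
    (((hW.tame_grad i).mul (hW.tame_grad k)).const_mul _), fun t ht v => ?_, fun t ht v i => ?_⟩
  · have hp := hW.posTame.pos t ht v
    refine ((hW.hasFDerivAt t ht v).rpow_const (p := c' / c) (Or.inl hp.ne')).congr_fderiv ?_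
    refine ContinuousLinearMap.ext fun w => ?_
    simp only [smul_apply, timeSpaceForm_apply, smul_eq_mul, mul_add, Finset.mul_sum,
      Real.rpow_sub_one hp.ne']
    refine congrArg₂ (· + ·) ?_ (Finset.sum_congr rfl fun i _ => ?_) <;> field_simp
  · have hp := hW.posTame.pos t ht
    have h1 : (fun v => W t v ^ (c' / c) * d i t v)
        = fun v => W t v ^ (c' / c - 1) * (W t v * d i t v) := by
      funext v
      rw [Real.rpow_sub_one (hp v).ne']
      have := (hp v).ne'
      field_simp
    rw [h1]
    refine (((hW.hasFDerivAt_space ht v).rpow_const (p := c' / c - 1)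
      (Or.inl (hp v).ne')).mul (hW.hasFDerivAt_grad t ht v i)).congr_fderiv ?_
    refine ContinuousLinearMap.ext fun w => ?_
    simp only [add_apply, smul_apply, spaceForm_apply, smul_eq_mul, Finset.mul_sum,
      ← Finset.sum_add_distrib, Real.rpow_sub_one (hp v).ne']
    refine Finset.sum_congr rfl fun k _ => ?_
    have := (hp v).ne'
    field_simp
    ring

/-- Undoes the normalization, so that the heat equation can be applied to `W` itself. -/
lemma isJet (hW : IsLogJet S c W h d q) :
    IsJet S W (fun t v => c * (W t v * h t v)) (fun i t v => c * (W t v * d i t v))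
      (fun i k t v => c * (W t v * q i k t v)) := by
  have hT := hW.posTame.tame
  refine ⟨hT, (hT.mul hW.tame_time).const_mul c,
    fun i => (hT.mul (hW.tame_grad i)).const_mul c,
    fun i k => (hT.mul (hW.tame_hess i k)).const_mul c, fun t ht v => ?_, fun t ht v i => ?_⟩
  · simpa only [mul_assoc] using hW.hasFDerivAt t ht v
  · refine ((hW.hasFDerivAt_grad t ht v i).const_mul c).congr_fderiv ?_
    refine ContinuousLinearMap.ext fun w => ?_
    simp [Finset.mul_sum, mul_assoc]

/-- The Hessian is the one for a power with `c' = 0`: the logarithm is the limiting last exponent.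
-/
lemma isJet_log (hW : IsLogJet S c W h d q) (hc : c ≠ 0) :
    IsJet S (fun t v => Real.log (W t v) / c) h d
      (fun i k t v => q i k t v - c * (d i t v * d k t v)) := by
  refine ⟨?_, hW.tame_time, hW.tame_grad, fun i k => (hW.tame_hess i k).sub
    (((hW.tame_grad i).mul (hW.tame_grad k)).const_mul _), fun t ht v => ?_, fun t ht v i => ?_⟩
  · simpa only [div_eq_mul_inv, mul_comm] using hW.posTame.tame_log.const_mul c⁻¹
  · have hp := (hW.posTame.pos t ht v).ne'
    simp only [div_eq_mul_inv]
    refine (((hW.hasFDerivAt t ht v).log hp).mul_const c⁻¹).congr_fderiv ?_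
    refine ContinuousLinearMap.ext fun w => ?_
    simp only [smul_apply, timeSpaceForm_apply, smul_eq_mul, mul_add, Finset.mul_sum]
    refine congrArg₂ (· + ·) ?_ (Finset.sum_congr rfl fun i _ => ?_) <;> field_simp
  · have hp := hW.posTame.pos t ht
    have h1 : d i t = fun v => (W t v)⁻¹ * (W t v * d i t v) := by
      funext v
      have := (hp v).ne'
      field_simp
    rw [h1]
    refine (((hasDerivAt_inv (hp v).ne').comp_hasFDerivAt v (hW.hasFDerivAt_space ht v)).mul
      (hW.hasFDerivAt_grad t ht v i)).congr_fderiv ?_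
    refine ContinuousLinearMap.ext fun w => ?_
    simp only [add_apply, smul_apply, spaceForm_apply, smul_eq_mul, Finset.mul_sum,
      ← Finset.sum_add_distrib, Function.comp_apply]
    refine Finset.sum_congr rfl fun k _ => ?_
    have := (hp v).ne'
    field_simp
    ring

end IsLogJet

/-- The average of `f` under the Gaussian measure reweighted by `U`. -/
noncomputable def tilt (σ : J → NNReal) (a : J → I → ℝ → ℝ) (U f : ℝ → (I → ℝ) → ℝ) (t : ℝ)
    (v : I → ℝ) : ℝ :=
  avg σ a (fun t v => U t v * f t v) t v / avg σ a U t v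

section Tilt

variable {a a' : J → I → ℝ → ℝ} {σ : J → NNReal} {U f g : ℝ → (I → ℝ) → ℝ}

omit [Fintype I] in
lemma tilt_congr {t : ℝ} (h : ∀ v, f t v = g t v) (v : I → ℝ) :
    tilt σ a U f t v = tilt σ a U g t v := by
  simp only [tilt, avg, h]

lemma SmoothCoeff.tame_tilt (ha : SmoothCoeff S a a') (hU : PosTame S U) (hf : Tame S f) :
    Tame S (tilt σ a U f) :=
  PosTame.tame_div (ha.tame_avg σ (hU.tame.mul hf)) (ha.posTame_avg σ hU)

lemma SmoothCoeff.tilt_sub (ha : SmoothCoeff S a a') (hU : PosTame S U) (hf : Tame S f)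
    (hg : Tame S g) {t : ℝ} (ht : t ∈ S) (v : I → ℝ) :
    tilt σ a U (fun t v => f t v - g t v) t v = tilt σ a U f t v - tilt σ a U g t v := by
  simp only [tilt, avg, mul_sub, ← sub_div]
  rw [integral_sub (ha.integrable σ (hU.tame.mul hf) ht v)
    (ha.integrable σ (hU.tame.mul hg) ht v)]

omit [Fintype I] in
lemma tilt_const_mul (r : ℝ) (t : ℝ) (v : I → ℝ) :
    tilt σ a U (fun t v => r * f t v) t v = r * tilt σ a U f t v := by
  simp only [tilt, avg, mul_left_comm _ r, integral_const_mul, mul_div_assoc]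

lemma SmoothCoeff.tilt_sum (ha : SmoothCoeff S a a') (hU : PosTame S U) {ι : Type*}
    {s : Finset ι} {F : ι → ℝ → (I → ℝ) → ℝ} (hF : ∀ i ∈ s, Tame S (F i)) {t : ℝ} (ht : t ∈ S)
    (v : I → ℝ) :
    tilt σ a U (fun t v => ∑ i ∈ s, F i t v) t v = ∑ i ∈ s, tilt σ a U (F i) t v := by
  simp only [tilt, avg, Finset.mul_sum, ← Finset.sum_div]
  rw [integral_finsetSum _ fun i hi => ha.integrable σ (hU.tame.mul (hF i hi)) ht v]

/-- Averaging preserves logarithmic jets. -/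
lemma IsLogJet.avg {c : ℝ} {h : ℝ → (I → ℝ) → ℝ} {d : I → ℝ → (I → ℝ) → ℝ}
    {q : I → I → ℝ → (I → ℝ) → ℝ} (hU : IsLogJet S c U h d q) (hc : c ≠ 0)
    (ha : SmoothCoeff S a a') (σ : J → NNReal) :
    IsLogJet S c (avg σ a U)
      (fun t v => tilt σ a U h t v
        + ∑ i, ∑ k, (∑ j, σ j * a' j i t * a j k t) * tilt σ a U (q i k) t v)
      (fun i => tilt σ a U (d i)) (fun i k => tilt σ a U (q i k)) := by
  have hj := hU.isJet.avg ha σ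
  have hP := ha.posTame_avg σ hU.posTame
  -- Averaging the unnormalized quantity `c U f` and factoring out the new positive function `avg σ
  -- a U` is what creates the reweighted average.
  have hcm : ∀ (f : ℝ → (I → ℝ) → ℝ) (t : ℝ), t ∈ S → ∀ v,
      GaussianInterpolation.avg σ a (fun t v => c * (U t v * f t v)) t v
        = c * GaussianInterpolation.avg σ a U t v * tilt σ a U f t v := by
    intro f t ht v
    have := (hP.pos t ht v).ne'
    rw [tilt]
    simp only [GaussianInterpolation.avg, integral_const_mul] at this ⊢
    field_simp
  refine ⟨hP, (PosTame.tame_div (hj.tame_time.const_mul c⁻¹) hP).congr ?_,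
    fun i => ha.tame_tilt hU.posTame (hU.tame_grad i),
    fun i k => ha.tame_tilt hU.posTame (hU.tame_hess i k), fun t ht v => ?_, fun t ht v i => ?_⟩
  · intro t ht v
    have := (hP.pos t ht v).ne'
    simp only [hcm _ t ht]
    rw [eq_div_iff this, eq_inv_mul_iff_mul_eq₀ hc, add_mul, mul_add, Finset.sum_mul,
      Finset.mul_sum]
    refine congrArg₂ (· + ·) (by ring) (Finset.sum_congr rfl fun i _ => ?_)
    rw [Finset.sum_mul, Finset.mul_sum]
    exact Finset.sum_congr rfl fun k _ => by ring
  · have h1 := hj.hasFDerivAt t ht v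
    simp only [hcm _ t ht] at h1
    convert h1 using 2
    rw [mul_add, Finset.mul_sum]
    refine congrArg₂ (· + ·) rfl (Finset.sum_congr rfl fun i _ => ?_)
    rw [Finset.mul_sum]
    exact Finset.sum_congr rfl fun k _ => by ring
  · have h1 := (hj.hasFDerivAt_grad t ht v i).const_mul c⁻¹
    have h2 : GaussianInterpolation.avg σ a (fun t v => c * (U t v * d i t v)) t
        = fun v => c * GaussianInterpolation.avg σ a U t v * tilt σ a U (d i) t v :=
      funext (hcm (d i) t ht)
    rw [h2] at h1
    simp only [hcm _ t ht] at h1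
    have h3 : ∀ x y : ℝ, c⁻¹ * (c * x * y) = x * y := fun x y => by field_simp
    simp only [h3] at h1
    refine h1.congr_fderiv ?_
    refine ContinuousLinearMap.ext fun w => ?_
    simp only [smul_apply, spaceForm_apply, smul_eq_mul, Finset.mul_sum]
    exact Finset.sum_congr rfl fun k _ => by field_simp

end Tilt

end LogJets

/-! ### The iterated averages and the telescoping of the Hessians. -/

section Tower

variable {I J : Type*} [Fintype I] [Fintype J] {S : Set ℝ}

/-- Iterated averages of powers of `W₀`, with successive exponents `c (k + 1) / c k`. -/
noncomputable def tower (σ : ℕ → J → NNReal) (a : J → I → ℝ → ℝ) (c : ℕ → ℝ)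
    (W₀ : ℝ → (I → ℝ) → ℝ) : ℕ → ℝ → (I → ℝ) → ℝ
  | 0 => W₀
  | k + 1 => avg (σ (k + 1)) a fun t v => tower σ a c W₀ k t v ^ (c (k + 1) / c k)

/-- The reweighted average over the layer `k + 1` of the tower. -/
noncomputable def tiltStep (σ : ℕ → J → NNReal) (a : J → I → ℝ → ℝ) (c : ℕ → ℝ)
    (W₀ : ℝ → (I → ℝ) → ℝ) (k : ℕ) (f : ℝ → (I → ℝ) → ℝ) : ℝ → (I → ℝ) → ℝ :=
  tilt (σ (k + 1)) a (fun t v => tower σ a c W₀ k t v ^ (c (k + 1) / c k)) f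

/-- The successive reweighted averages over the layers `b`, …, `k` of the tower. -/
noncomputable def tiltChain (σ : ℕ → J → NNReal) (a : J → I → ℝ → ℝ) (c : ℕ → ℝ)
    (W₀ : ℝ → (I → ℝ) → ℝ) (b : ℕ) : ℕ → (ℝ → (I → ℝ) → ℝ) → ℝ → (I → ℝ) → ℝ
  | 0, f => f
  | k + 1, f =>
    if b ≤ k + 1 then tiltStep σ a c W₀ k (tiltChain σ a c W₀ b k f) else f

variable {σ : ℕ → J → NNReal} {a a' : J → I → ℝ → ℝ} {c : ℕ → ℝ} {W₀ : ℝ → (I → ℝ) → ℝ}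

lemma posTame_tower (ha : SmoothCoeff S a a') (hW : PosTame S W₀) (k : ℕ) :
    PosTame S (tower σ a c W₀ k) := by
  induction k with
  | zero => exact hW
  | succ k ih => exact ha.posTame_avg _ (ih.rpow _)

omit [Fintype I] in
lemma tiltChain_of_lt {b k : ℕ} (h : k < b) (f : ℝ → (I → ℝ) → ℝ) :
    tiltChain σ a c W₀ b k f = f := by
  cases k with
  | zero => rfl
  | succ k => rw [tiltChain, if_neg (by omega)]

omit [Fintype I] in
lemma tiltChain_succ {b k : ℕ} (h : b ≤ k + 1) (f : ℝ → (I → ℝ) → ℝ) :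
    tiltChain σ a c W₀ b (k + 1) f = tiltStep σ a c W₀ k (tiltChain σ a c W₀ b k f) := by
  rw [tiltChain, if_pos h]

lemma tame_tiltStep (ha : SmoothCoeff S a a') (hW : PosTame S W₀) (k : ℕ)
    {f : ℝ → (I → ℝ) → ℝ} (hf : Tame S f) : Tame S (tiltStep σ a c W₀ k f) :=
  ha.tame_tilt ((posTame_tower ha hW k).rpow _) hf

lemma tame_tiltChain (ha : SmoothCoeff S a a') (hW : PosTame S W₀) (b k : ℕ)
    {f : ℝ → (I → ℝ) → ℝ} (hf : Tame S f) : Tame S (tiltChain σ a c W₀ b k f) := by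
  induction k with
  | zero => exact hf
  | succ k ih =>
    rw [tiltChain]
    split_ifs
    · exact tame_tiltStep ha hW k ih
    · exact hf

omit [Fintype I] in
lemma tiltStep_congr {k : ℕ} {f g : ℝ → (I → ℝ) → ℝ} {t : ℝ} (h : ∀ v, f t v = g t v)
    (v : I → ℝ) : tiltStep σ a c W₀ k f t v = tiltStep σ a c W₀ k g t v :=
  tilt_congr h v

omit [Fintype I] in
lemma tiltChain_const_mul (b k : ℕ) (r : ℝ) {f : ℝ → (I → ℝ) → ℝ} (t : ℝ) (v : I → ℝ) :
    tiltChain σ a c W₀ b k (fun t v => r * f t v) t v = r * tiltChain σ a c W₀ b k f t v := by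
  induction k generalizing v with
  | zero => rfl
  | succ k ih =>
    simp only [tiltChain]
    split_ifs
    · rw [tiltStep_congr (g := fun t v => r * tiltChain σ a c W₀ b k f t v) (fun v => ih v) v]
      exact tilt_const_mul r t v
    · rfl

lemma tiltChain_sum (ha : SmoothCoeff S a a') (hW : PosTame S W₀) (b k : ℕ) {ι : Type*}
    {s : Finset ι} {F : ι → ℝ → (I → ℝ) → ℝ} (hF : ∀ i ∈ s, Tame S (F i)) {t : ℝ} (ht : t ∈ S)
    (v : I → ℝ) :
    tiltChain σ a c W₀ b k (fun t v => ∑ i ∈ s, F i t v) t v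
      = ∑ i ∈ s, tiltChain σ a c W₀ b k (F i) t v := by
  induction k generalizing v with
  | zero => rfl
  | succ k ih =>
    simp only [tiltChain]
    split_ifs
    · rw [tiltStep_congr (g := fun t v => ∑ i ∈ s, tiltChain σ a c W₀ b k (F i) t v)
        (fun v => ih v) v]
      exact ha.tilt_sum ((posTame_tower ha hW k).rpow _)
        (fun i hi => tame_tiltChain ha hW b k (hF i hi)) ht v
    · rfl

lemma tiltChain_linear (ha : SmoothCoeff S a a') (hW : PosTame S W₀) (b k : ℕ) {ι : Type*}
    [Fintype ι] (w : ι → ℝ) {F : ι → ℝ → (I → ℝ) → ℝ} (hF : ∀ i, Tame S (F i)) {t : ℝ}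
    (ht : t ∈ S) (v : I → ℝ) :
    tiltChain σ a c W₀ b k (fun t v => ∑ i, w i * F i t v) t v
      = ∑ i, w i * tiltChain σ a c W₀ b k (F i) t v := by
  rw [tiltChain_sum ha hW b k (fun i _ => (hF i).const_mul (w i)) ht v]
  exact Finset.sum_congr rfl fun i _ => tiltChain_const_mul b k (w i) t v

/-- The contribution of the layer `b` to the time derivative, before averaging. -/
noncomputable def overlapTerm (σ : ℕ → J → NNReal) (a : J → I → ℝ → ℝ) (c : ℕ → ℝ)
    (W₀ : ℝ → (I → ℝ) → ℝ) (κ : ℕ → I → I → ℝ) (d : I → ℝ → (I → ℝ) → ℝ) (b : ℕ) (t : ℝ)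
    (v : I → ℝ) : ℝ :=
  ∑ i, ∑ j, κ b i j * ((c b - c (b + 1))
    * (tiltChain σ a c W₀ 1 b (d i) t v * tiltChain σ a c W₀ 1 b (d j) t v))

/-- The time derivative of the tower up to the Hessian contribution of the remaining layers. -/
noncomputable def totalTerm (σ : ℕ → J → NNReal) (a : J → I → ℝ → ℝ) (c : ℕ → ℝ)
    (W₀ : ℝ → (I → ℝ) → ℝ) (κ : ℕ → I → I → ℝ) (d : I → ℝ → (I → ℝ) → ℝ)
    (ρ : ℝ → (I → ℝ) → ℝ) (e k : ℕ) (t : ℝ) (v : I → ℝ) : ℝ :=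
  tiltChain σ a c W₀ 1 k ρ t v - ∑ b ∈ Finset.Icc 1 e,
    tiltChain σ a c W₀ b k (overlapTerm σ a c W₀ κ d (b - 1)) t v

variable {κ : ℕ → I → I → ℝ} {h₀ : ℝ → (I → ℝ) → ℝ} {d : I → ℝ → (I → ℝ) → ℝ}
  {q₀ : I → I → ℝ → (I → ℝ) → ℝ}

lemma tame_overlapTerm (ha : SmoothCoeff S a a') (hW : PosTame S W₀) (hd : ∀ i, Tame S (d i))
    (b : ℕ) : Tame S (overlapTerm σ a c W₀ κ d b) :=
  Tame.sum fun i _ => Tame.sum fun j _ => Tame.const_mul _ (Tame.const_mul _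
    ((tame_tiltChain ha hW 1 b (hd i)).mul (tame_tiltChain ha hW 1 b (hd j))))

lemma tame_totalTerm (ha : SmoothCoeff S a a') (hW : PosTame S W₀) (hd : ∀ i, Tame S (d i))
    {ρ : ℝ → (I → ℝ) → ℝ} (hρ : Tame S ρ) (e k : ℕ) :
    Tame S (totalTerm σ a c W₀ κ d ρ e k) :=
  (tame_tiltChain ha hW 1 k hρ).sub
    (Tame.sum fun b _ => tame_tiltChain ha hW b k (tame_overlapTerm ha hW hd (b - 1)))

/-- The newest overlap term has not been averaged yet: its chain starts above level `k` and is the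
identity. -/
lemma totalTerm_succ_left {ρ : ℝ → (I → ℝ) → ℝ} (k : ℕ) (t : ℝ) (v : I → ℝ) :
    totalTerm σ a c W₀ κ d ρ (k + 1) k t v
      = totalTerm σ a c W₀ κ d ρ k k t v - overlapTerm σ a c W₀ κ d k t v := by
  rw [totalTerm, Finset.sum_Icc_succ_top (by omega), tiltChain_of_lt (Nat.lt_succ_self k),
    totalTerm, Nat.add_sub_cancel]
  ring

/-- All chains present start at or below `k + 1`, so the reweighted average over that layer factors
out by linearity. -/
lemma totalTerm_succ_right (ha : SmoothCoeff S a a') (hW : PosTame S W₀)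
    (hd : ∀ i, Tame S (d i)) {ρ : ℝ → (I → ℝ) → ℝ} (hρ : Tame S ρ) (k : ℕ) {t : ℝ} (ht : t ∈ S)
    (v : I → ℝ) :
    totalTerm σ a c W₀ κ d ρ (k + 1) (k + 1) t v
      = tiltStep σ a c W₀ k (totalTerm σ a c W₀ κ d ρ (k + 1) k) t v := by
  have h1 : ∀ b ∈ Finset.Icc 1 (k + 1),
      tiltChain σ a c W₀ b (k + 1) (overlapTerm σ a c W₀ κ d (b - 1)) t v
        = tiltStep σ a c W₀ k (tiltChain σ a c W₀ b k (overlapTerm σ a c W₀ κ d (b - 1))) t v :=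
    fun b hb => by rw [tiltChain_succ (Finset.mem_Icc.1 hb).2]
  have hU := (posTame_tower (σ := σ) (c := c) ha hW k).rpow (c (k + 1) / c k)
  have h2 : ∀ b ∈ Finset.Icc 1 (k + 1),
      Tame S (tiltChain σ a c W₀ b k (overlapTerm σ a c W₀ κ d (b - 1))) :=
    fun b _ => tame_tiltChain ha hW b k (tame_overlapTerm ha hW hd (b - 1))
  rw [totalTerm, tiltChain_succ (by omega), Finset.sum_congr rfl h1]
  have h3 := ha.tilt_sub (σ := σ (k + 1)) hU (tame_tiltChain (σ := σ) (c := c) ha hW 1 k hρ)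
    (Tame.sum h2) ht v
  rw [ha.tilt_sum hU h2 ht v] at h3
  exact h3.symm

/-- The logarithmic jets of the tower. -/
theorem isLogJet_tower (ha : SmoothCoeff S a a') {r : ℕ} (hc : ∀ k ≤ r, c k ≠ 0)
    (hκ : ∀ k < r, ∀ t ∈ S, ∀ i j,
      ∑ l, σ (k + 1) l * a' l i t * a l j t = κ k i j - κ (k + 1) i j)
    (hW : IsLogJet S (c 0) W₀ h₀ d q₀) {k : ℕ} (hk : k ≤ r) :
    ∃ q, IsLogJet S (c k) (tower σ a c W₀ k)
      (fun t v => totalTerm σ a c W₀ κ d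
        (fun t v => h₀ t v + ∑ i, ∑ j, κ 0 i j * q₀ i j t v) k k t v
          - ∑ i, ∑ j, κ k i j * q i j t v)
      (fun i => tiltChain σ a c W₀ 1 k (d i)) q := by
  induction k with
  | zero =>
    -- At level `0` the term `κ 0 · q₀` is added inside `ρ` and subtracted again, which starts the
    -- telescoping.
    refine ⟨q₀, hW.congr_time (fun t ht v => ?_) fun i t ht v => rfl⟩
    simp [totalTerm, tiltChain]
  | succ k ih =>
    obtain ⟨q, hq⟩ := ih (by omega)
    set ρ : ℝ → (I → ℝ) → ℝ := fun t v => h₀ t v + ∑ i, ∑ j, κ 0 i j * q₀ i j t v with hρdef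
    have hρ : Tame S ρ := hW.tame_time.add
      (Tame.sum fun i _ => Tame.sum fun j _ => (hW.tame_hess i j).const_mul _)
    have hP := posTame_tower (σ := σ) (c := c) ha hW.posTame k
    have hU := hP.rpow (c (k + 1) / c k)
    have hstep := (hq.rpow (hc k (by omega)) (c (k + 1))).avg (hc (k + 1) hk) ha (σ (k + 1))
    refine ⟨_, hstep.congr_time (fun t ht v => ?_) fun i t ht v => by
      rw [tiltChain_succ (by omega)]; rfl⟩
    have e0 : ∀ X : I → I → ℝ, ∑ i, ∑ j, (κ k i j - κ (k + 1) i j) * X i j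
        = ∑ i, ∑ j, κ k i j * X i j - ∑ i, ∑ j, κ (k + 1) i j * X i j := fun X => by
      simp only [sub_mul, Finset.sum_sub_distrib]
    simp only [hκ k (by omega) t ht, e0]
    rw [totalTerm_succ_right ha hW.posTame hW.tame_grad hρ k ht v]
    -- The part with `κ (k + 1)` already matches the Hessian term handed to the next level. In the
    -- rest, `- κ k · q` from the induction hypothesis and `+ κ k · q` from the heat equation cancel
    -- under the reweighted average, leaving the new overlap term.
    suffices h : tiltStep σ a c W₀ k (totalTerm σ a c W₀ κ d ρ (k + 1) k) t v
        = tiltStep σ a c W₀ k (fun t v => totalTerm σ a c W₀ κ d ρ k k t v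
            - ∑ i, ∑ j, κ k i j * q i j t v) t v
          + ∑ i, ∑ j, κ k i j * tilt (σ (k + 1)) a
            (fun t v => tower σ a c W₀ k t v ^ (c (k + 1) / c k))
            (fun t v => q i j t v - (c k - c (k + 1))
              * (tiltChain σ a c W₀ 1 k (d i) t v * tiltChain σ a c W₀ 1 k (d j) t v)) t v by
      rw [h]
      exact add_sub_assoc _ _ _
    have hqt : ∀ i j, Tame S (fun t v => q i j t v - (c k - c (k + 1))
        * (tiltChain σ a c W₀ 1 k (d i) t v * tiltChain σ a c W₀ 1 k (d j) t v)) :=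
      fun i j => (hq.tame_hess i j).sub
        (((hq.tame_grad i).mul (hq.tame_grad j)).const_mul _)
    have hqs : Tame S (fun t v => ∑ i, ∑ j, κ k i j * (q i j t v - (c k - c (k + 1))
        * (tiltChain σ a c W₀ 1 k (d i) t v * tiltChain σ a c W₀ 1 k (d j) t v))) :=
      Tame.sum fun i _ => Tame.sum fun j _ => (hqt i j).const_mul _
    have hT := tame_totalTerm (σ := σ) (c := c) (κ := κ) ha hW.posTame hW.tame_grad hρ (k + 1) k
    have e1 : ∑ i, ∑ j, κ k i j * tilt (σ (k + 1)) a
            (fun t v => tower σ a c W₀ k t v ^ (c (k + 1) / c k))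
            (fun t v => q i j t v - (c k - c (k + 1))
              * (tiltChain σ a c W₀ 1 k (d i) t v * tiltChain σ a c W₀ 1 k (d j) t v)) t v
        = tiltStep σ a c W₀ k (fun t v => ∑ i, ∑ j, κ k i j * (q i j t v - (c k - c (k + 1))
        * (tiltChain σ a c W₀ 1 k (d i) t v * tiltChain σ a c W₀ 1 k (d j) t v))) t v := by
      rw [tiltStep, ha.tilt_sum hU
        (fun i _ => Tame.sum fun j _ => (hqt i j).const_mul (κ k i j)) ht v]
      refine Finset.sum_congr rfl fun i _ => ?_
      rw [ha.tilt_sum hU (fun j _ => (hqt i j).const_mul (κ k i j)) ht v]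
      exact Finset.sum_congr rfl fun j _ => (tilt_const_mul _ _ _).symm
    rw [e1, ← sub_eq_iff_eq_add]
    refine Eq.trans (ha.tilt_sub hU hT hqs ht v).symm (tiltStep_congr (fun v => ?_) v)
    simp only [totalTerm_succ_left, overlapTerm, mul_sub, Finset.sum_sub_distrib]
    ring

variable {J' : Type*} [Fintype J'] {σ' : J' → NNReal} {α α' : J' → I → ℝ → ℝ}

/-- The derivative of the interpolating function. -/
theorem hasDerivAt_avg_log_tower (ha : SmoothCoeff S a a') (hα : SmoothCoeff S α α') {r : ℕ}
    (hc : ∀ k ≤ r, c k ≠ 0) (hcr : c (r + 1) = 0)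
    (hκ : ∀ k < r, ∀ t ∈ S, ∀ i j,
      ∑ l, σ (k + 1) l * a' l i t * a l j t = κ k i j - κ (k + 1) i j)
    (hκ' : ∀ t ∈ S, ∀ i j, ∑ l, σ' l * α' l i t * α l j t = κ r i j)
    (hW : IsLogJet S (c 0) W₀ h₀ d q₀) {t : ℝ} (ht : t ∈ S) (v : I → ℝ) :
    HasDerivAt (fun τ => avg σ' α (fun t v => Real.log (tower σ a c W₀ r t v) / c r) τ v)
      (avg σ' α (totalTerm σ a c W₀ κ d
        (fun t v => h₀ t v + ∑ i, ∑ j, κ 0 i j * q₀ i j t v) (r + 1) r) t v) t := by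
  -- The Hessian `q` need not be identified: it cancels in the last average against the term of
  -- weight `κ r`.
  obtain ⟨q, hq⟩ := isLogJet_tower ha hc hκ hW le_rfl
  have hj := hq.isJet_log (hc r le_rfl)
  have h1 := (hj.avg hα σ').hasFDerivAt t ht v
  have h2 := h1.comp_hasDerivAt t ((hasDerivAt_id t).prodMk (hasDerivAt_const t v))
  refine h2.congr_deriv ?_
  simp only [timeSpaceForm_apply, mul_one, Pi.zero_apply, mul_zero, Finset.sum_const_zero,
    add_zero, hκ' t ht]
  have hI : ∀ {f : ℝ → (I → ℝ) → ℝ}, Tame S f →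
      Integrable (fun z => f t (v + linImage α t z)) (gaussPi σ') :=
    fun hf => hα.integrable σ' hf ht v
  have e1 : ∑ i, ∑ j, κ r i j * avg σ' α (fun t v => q i j t v - c r
        * (tiltChain σ a c W₀ 1 r (d i) t v * tiltChain σ a c W₀ 1 r (d j) t v)) t v
      = avg σ' α (fun t v => ∑ i, ∑ j, κ r i j * (q i j t v - c r
        * (tiltChain σ a c W₀ 1 r (d i) t v * tiltChain σ a c W₀ 1 r (d j) t v))) t v := by
    simp only [avg]
    rw [integral_finsetSum _ fun i _ => hI (Tame.sum fun j _ =>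
      (hj.tame_hess i j).const_mul (κ r i j))]
    refine Finset.sum_congr rfl fun i _ => ?_
    rw [integral_finsetSum _ fun j _ => hI ((hj.tame_hess i j).const_mul (κ r i j))]
    exact Finset.sum_congr rfl fun j _ => (integral_const_mul _ _).symm
  rw [e1]
  unfold avg
  rw [← integral_add (hI hj.tame_time) (hI (Tame.sum fun i _ => Tame.sum fun j _ =>
      (hj.tame_hess i j).const_mul (κ r i j)))]
  refine integral_congr_ae (ae_of_all _ fun z => ?_)
  -- As `c (r + 1) = 0`, the coefficient `c r` in the Hessian of the logarithm equals the difference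
  -- `c r - c (r + 1)` required by the overlap term.
  simp only [totalTerm_succ_left, overlapTerm, mul_sub, Finset.sum_sub_distrib, hcr, sub_zero]
  ring

end Tower

end GaussianInterpolation

namespace FullLifting

open GaussianInterpolation

/-! ### Identification of the concrete model with the abstract tower. -/

section Bridge

variable {m n l : ℕ}

instance (d : ℕ) (v : ℝ) : IsProbabilityMeasure (gaussVec d v) := by
  unfold gaussVec; infer_instance

instance : IsProbabilityMeasure (matLaw m n) := by
  unfold matLaw; infer_instance

instance (p q : ℕ → ℝ) (k : ℕ) : IsProbabilityMeasure (layerLaw m n p q k) := by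
  unfold layerLaw; infer_instance

/-- The index set of the components of a layer. -/
abbrev LayerIdx (m n : ℕ) : Type := Unit ⊕ Fin m ⊕ Fin n

/-- The components of a layer as one vector. -/
def layerVec (u : Layer m n) : LayerIdx m n → ℝ :=
  Sum.elim (fun _ => u.1) (Sum.elim u.2.1 u.2.2)

/-- The variances of the components of the layer `k`. -/
def layerVar (m n : ℕ) (p q : ℕ → ℝ) (k : ℕ) : LayerIdx m n → NNReal :=
  Sum.elim (fun _ => (p (k - 1) * q (k - 1) - p k * q k).toNNReal)
    (Sum.elim (fun _ => (p (k - 1) - p k).toNNReal) (fun _ => (q (k - 1) - q k).toNNReal))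

lemma integral_gaussPi_sum {J J' E : Type*} [Fintype J] [Fintype J'] [NormedAddCommGroup E]
    [NormedSpace ℝ E] (σ : J → NNReal) (σ' : J' → NNReal) (f : (J ⊕ J' → ℝ) → E) :
    ∫ z, f z ∂gaussPi (Sum.elim σ σ')
      = ∫ z, f (Sum.elim z.1 z.2) ∂((gaussPi σ).prod (gaussPi σ')) :=
  ((measurePreserving_sumPiEquivProdPi_symm
    (fun j => gaussianReal 0 (Sum.elim σ σ' j))).integral_comp' f).symm

/-- Having a measurable equivalence, and not merely a measure-preserving map, allows the change of
variables for arbitrary integrands without measurability conditions. -/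
lemma map_layerVec (p q : ℕ → ℝ) (k : ℕ) : ∃ e : Layer m n ≃ᵐ (LayerIdx m n → ℝ),
    (∀ u, e u = layerVec u) ∧ MeasurePreserving e (layerLaw m n p q k)
      (gaussPi (layerVar m n p q k)) := by
  have h1 := measurePreserving_sumPiEquivProdPi_symm (ι := Fin m) (ι' := Fin n)
    (fun j => gaussianReal 0 ((Sum.elim (fun _ => (p (k - 1) - p k).toNNReal)
      (fun _ => (q (k - 1) - q k).toNNReal) : Fin m ⊕ Fin n → NNReal) j))
  have h0 := (measurePreserving_funUnique
    (gaussianReal 0 (p (k - 1) * q (k - 1) - p k * q k).toNNReal) Unit).symm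
  have h2 := measurePreserving_sumPiEquivProdPi_symm (ι := Unit) (ι' := Fin m ⊕ Fin n)
    (fun j => gaussianReal 0 (layerVar m n p q k j))
  refine ⟨((MeasurableEquiv.funUnique Unit ℝ).symm.prodCongr
    (MeasurableEquiv.sumPiEquivProdPi (fun _ : Fin m ⊕ Fin n => ℝ)).symm).trans
      (MeasurableEquiv.sumPiEquivProdPi (fun _ : LayerIdx m n => ℝ)).symm, fun u => ?_, ?_⟩
  · funext j
    rcases j with j | j | j <;> rfl
  · exact h2.comp (h0.prod h1)

lemma integral_layerLaw (p q : ℕ → ℝ) (k : ℕ) (f : (LayerIdx m n → ℝ) → ℝ) :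
    ∫ u, f (layerVec u) ∂layerLaw m n p q k = ∫ z, f z ∂gaussPi (layerVar m n p q k) := by
  obtain ⟨e, he, hm⟩ := map_layerVec (m := m) (n := n) p q k
  simp only [← he]
  exact hm.integral_comp' f

/-- The components of `G` and of a layer as one vector. -/
def outerVec (z : (Fin m → Fin n → ℝ) × Layer m n) : (Fin m × Fin n) ⊕ LayerIdx m n → ℝ :=
  Sum.elim (fun j => z.1 j.1 j.2) (layerVec z.2)

/-- The variances of the components of `G` and of the layer `k`. -/
def outerVar (m n : ℕ) (p q : ℕ → ℝ) (k : ℕ) : (Fin m × Fin n) ⊕ LayerIdx m n → NNReal :=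
  Sum.elim (fun _ => 1) (layerVar m n p q k)

lemma measurePreserving_uncurry : MeasurePreserving (MeasurableEquiv.curry (Fin m) (Fin n) ℝ).symm
    (matLaw m n) (gaussPi fun _ => 1) := by
  refine ⟨(MeasurableEquiv.curry (Fin m) (Fin n) ℝ).symm.measurable,
    (Measure.pi_eq fun s hs => ?_).symm⟩
  rw [MeasurableEquiv.map_apply]
  have : (MeasurableEquiv.curry (Fin m) (Fin n) ℝ).symm ⁻¹' (Set.univ.pi s)
      = Set.univ.pi fun a => Set.univ.pi fun b => s (a, b) := by
    ext G
    simp only [Set.mem_preimage, Set.mem_univ_pi, Prod.forall]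
    rfl
  rw [this, matLaw, Measure.pi_pi, Fintype.prod_prod_type]
  simp only [Measure.pi_pi]

lemma integral_outer (p q : ℕ → ℝ) (k : ℕ)
    (f : ((Fin m × Fin n) ⊕ LayerIdx m n → ℝ) → ℝ) :
    ∫ z, f (outerVec z) ∂((matLaw m n).prod (layerLaw m n p q k))
      = ∫ z, f z ∂gaussPi (outerVar m n p q k) := by
  obtain ⟨e, he, hm⟩ := map_layerVec (m := m) (n := n) p q k
  rw [outerVar, integral_gaussPi_sum]
  have h := (measurePreserving_uncurry (m := m) (n := n)).prod hm
  have h' : MeasurePreserving ((MeasurableEquiv.curry (Fin m) (Fin n) ℝ).symm.prodCongr e)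
      ((matLaw m n).prod (layerLaw m n p q k)) _ := h
  rw [← h'.integral_comp']
  refine integral_congr_ae (ae_of_all _ fun z => ?_)
  show f (outerVec z) = f (Sum.elim _ (e z.2))
  rw [he]
  rfl

variable (x : Fin l → EuclideanSpace ℝ (Fin n)) (y : Fin l → EuclideanSpace ℝ (Fin m))

/-- The time dependence of the coefficients of a layer. -/
noncomputable def layerPhase : LayerIdx m n → ℝ → ℝ :=
  Sum.elim (fun _ t => √t) (fun _ t => √(1 - t))

/-- The time derivative of `layerPhase`. -/
noncomputable def layerPhaseDeriv : LayerIdx m n → ℝ → ℝ :=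
  Sum.elim (fun _ t => 1 / (2 * √t)) (fun _ t => -(1 / (2 * √(1 - t))))

/-- The constant factors of the coefficients of a layer. -/
noncomputable def layerWeight : LayerIdx m n → Fin l × Fin l → ℝ :=
  Sum.elim (fun _ i => ‖x i.1‖ * ‖y i.2‖)
    (Sum.elim (fun a i => ‖x i.1‖ * y i.2 a) (fun b i => ‖y i.2‖ * x i.1 b))

/-- The coefficients of a layer in the process `D₀`. -/
noncomputable def layerCoeff (j : LayerIdx m n) (i : Fin l × Fin l) (t : ℝ) : ℝ :=
  layerPhase j t * layerWeight x y j i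

/-- The time dependence of the coefficients of `G` and of a layer. -/
noncomputable def outerPhase : (Fin m × Fin n) ⊕ LayerIdx m n → ℝ → ℝ :=
  Sum.elim (fun _ t => √t) layerPhase

/-- The time derivative of `outerPhase`. -/
noncomputable def outerPhaseDeriv : (Fin m × Fin n) ⊕ LayerIdx m n → ℝ → ℝ :=
  Sum.elim (fun _ t => 1 / (2 * √t)) layerPhaseDeriv

/-- The constant factors of the coefficients of `G` and of a layer. -/
noncomputable def outerWeight : (Fin m × Fin n) ⊕ LayerIdx m n → Fin l × Fin l → ℝ :=
  Sum.elim (fun j i => y i.2 j.1 * x i.1 j.2) (layerWeight x y)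

/-- The coefficients of `G` and of a layer in the process `D₀`. -/
noncomputable def outerCoeff (j : (Fin m × Fin n) ⊕ LayerIdx m n) (i : Fin l × Fin l) (t : ℝ) :
    ℝ :=
  outerPhase j t * outerWeight x y j i

/-- The part of the process `D₀` that depends on `G` and on the layers after `k`. -/
noncomputable def tailField (r : ℕ) (t : ℝ) (k : ℕ) (ω : Sample m n) (i : Fin l × Fin l) : ℝ :=
  √t * (∑ a, ∑ b, y i.2 a * ω.1 a b * x i.1 b)
    + ∑ j ∈ Finset.Icc (k + 1) (r + 1), linImage (layerCoeff x y) t (layerVec (ω.2 j)) i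

lemma linImage_layerCoeff (t : ℝ) (u : Layer m n) (i : Fin l × Fin l) :
    linImage (layerCoeff x y) t (layerVec u) i
      = √t * (‖x i.1‖ * ‖y i.2‖) * u.1
        + (∑ a, √(1 - t) * (‖x i.1‖ * y i.2 a) * u.2.1 a
          + ∑ b, √(1 - t) * (‖y i.2‖ * x i.1 b) * u.2.2 b) := by
  simp [linImage, layerCoeff, layerPhase, layerWeight, layerVec, Fintype.sum_sum_type]

lemma D₀_eq_tailField (r : ℕ) (t : ℝ) (i₁ i₂ : Fin l) (ω : Sample m n) :
    D₀ r x y t i₁ i₂ ω = tailField x y r t 0 ω (i₁, i₂) := by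
  simp only [D₀, tailField, linImage_layerCoeff, Finset.sum_add_distrib, zero_add]
  have h1 : √(1 - t) * ‖x i₁‖ * ∑ a, y i₂ a * ∑ k ∈ Finset.Icc 1 (r + 1), (ω.2 k).2.1 a
      = ∑ k ∈ Finset.Icc 1 (r + 1), ∑ a, √(1 - t) * (‖x i₁‖ * y i₂ a) * (ω.2 k).2.1 a := by
    rw [Finset.sum_comm, Finset.mul_sum]
    refine Finset.sum_congr rfl fun a _ => ?_
    rw [← Finset.mul_sum]
    ring
  have h2 : √(1 - t) * ‖y i₂‖ * ∑ b, (∑ k ∈ Finset.Icc 1 (r + 1), (ω.2 k).2.2 b) * x i₁ b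
      = ∑ k ∈ Finset.Icc 1 (r + 1), ∑ b, √(1 - t) * (‖y i₂‖ * x i₁ b) * (ω.2 k).2.2 b := by
    rw [Finset.sum_comm, Finset.mul_sum]
    refine Finset.sum_congr rfl fun b _ => ?_
    rw [← Finset.mul_sum]
    ring
  rw [h1, h2, ← Finset.mul_sum]
  ring

/-- Layer `k + 1` enters linearly and additively, so its average is a Gaussian translation average
of a function of the remaining field. -/
lemma tailField_update {r k : ℕ} (hk : k ≤ r) (t : ℝ) (ω : Sample m n) (u : Layer m n) :
    tailField x y r t k (ω.1, Function.update ω.2 (k + 1) u)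
      = tailField x y r t (k + 1) ω + linImage (layerCoeff x y) t (layerVec u) := by
  funext i
  simp only [tailField, Pi.add_apply]
  rw [← Finset.add_sum_Ioc_eq_sum_Icc (by omega : k + 1 ≤ r + 1), Function.update_self,
    ← Finset.Icc_add_one_left_eq_Ioc]
  have : ∀ j ∈ Finset.Icc (k + 1 + 1) (r + 1),
      linImage (layerCoeff x y) t (layerVec (Function.update ω.2 (k + 1) u j)) i
        = linImage (layerCoeff x y) t (layerVec (ω.2 j)) i := fun j hj => by
    rw [Function.update_of_ne]
    have := (Finset.mem_Icc.1 hj).1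
    omega
  rw [Finset.sum_congr rfl this]
  ring

/-- Consequently `ζ_{k+1}` is constant in the average over layer `k + 1`, and its inverse can leave
the integral. -/
lemma tailField_succ_update (r k : ℕ) (t : ℝ) (ω : Sample m n) (u : Layer m n) :
    tailField x y r t (k + 1) (ω.1, Function.update ω.2 (k + 1) u)
      = tailField x y r t (k + 1) ω := by
  funext i
  simp only [tailField]
  congr 1
  refine Finset.sum_congr rfl fun j hj => ?_
  rw [Function.update_of_ne]
  have := (Finset.mem_Icc.1 hj).1
  omega

lemma layerExp_tailField (p q : ℕ → ℝ) {r k : ℕ} (hk : k ≤ r)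
    (f : ℝ → (Fin l × Fin l → ℝ) → ℝ) (t : ℝ) (ω : Sample m n) :
    layerExp p q (k + 1) (fun ω => f t (tailField x y r t k ω)) ω
      = avg (layerVar m n p q (k + 1)) (layerCoeff x y) f t (tailField x y r t (k + 1) ω) := by
  simp only [layerExp, tailField_update x y hk]
  exact integral_layerLaw p q (k + 1)
    fun z => f t (tailField x y r t (k + 1) ω + linImage (layerCoeff x y) t z)

lemma tailField_outer (r : ℕ) (t : ℝ) (z : (Fin m → Fin n → ℝ) × Layer m n) :
    tailField x y r t r (z.1, Function.update 0 (r + 1) z.2)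
      = linImage (outerCoeff x y) t (outerVec z) := by
  funext i
  simp only [tailField, Finset.Icc_self, Finset.sum_singleton, Function.update_self]
  have h1 : linImage (outerCoeff x y) t (outerVec z) i
      = ∑ j : Fin m × Fin n, √t * (y i.2 j.1 * x i.1 j.2) * z.1 j.1 j.2
        + linImage (layerCoeff x y) t (layerVec z.2) i := by
    simp only [linImage, outerCoeff, outerPhase, outerWeight, outerVec, Fintype.sum_sum_type,
      Sum.elim_inl, Sum.elim_inr, layerCoeff]
  rw [h1, Fintype.sum_prod_type, Finset.mul_sum]
  congr 1
  refine Finset.sum_congr rfl fun a _ => ?_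
  rw [Finset.mul_sum]
  exact Finset.sum_congr rfl fun b _ => by ring

/-- At level `r` only `G` and layer `r + 1` remain, and the field is linear in them; hence the base
point `0`, whatever values the earlier layers receive. -/
lemma outerExp_tailField (p q : ℕ → ℝ) (r : ℕ) (f : ℝ → (Fin l × Fin l → ℝ) → ℝ) (t : ℝ) :
    outerExp p q r (fun ω : Sample m n => f t (tailField x y r t r ω))
      = avg (outerVar m n p q (r + 1)) (outerCoeff x y) f t 0 := by
  simp only [outerExp, tailField_outer, avg, zero_add]
  exact integral_outer p q (r + 1) fun z => f t (linImage (outerCoeff x y) t z)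

/-- `C` as a function of the values of the process `D₀`. -/
noncomputable def gibbsC (β : ℝ) (i₁ : Fin l) (v : Fin l × Fin l → ℝ) : ℝ :=
  ∑ i₂, Real.exp (β * v (i₁, i₂))

/-- `Z` as a function of the values of the process `D₀`. -/
noncomputable def gibbsZ (β s : ℝ) (v : Fin l × Fin l → ℝ) : ℝ := ∑ i₁, gibbsC β i₁ v ^ s

/-- `γ₀` as a function of the values of the process `D₀`. -/
noncomputable def gibbsWeight (β s : ℝ) (i : Fin l × Fin l) (v : Fin l × Fin l → ℝ) : ℝ :=
  gibbsC β i.1 v ^ s / gibbsZ β s v * (Real.exp (β * v i) / gibbsC β i.1 v)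

/-- The weight averaged in `γ₀₂`, as a function of the values of the process `D₀`. -/
noncomputable def gibbsPairWeight (β s : ℝ) (i₁ i₂ p₂ : Fin l) (v : Fin l × Fin l → ℝ) : ℝ :=
  gibbsC β i₁ v ^ s / gibbsZ β s v * (Real.exp (β * v (i₁, i₂)) / gibbsC β i₁ v)
    * (Real.exp (β * v (i₁, p₂)) / gibbsC β i₁ v)

variable (p q c : ℕ → ℝ) (β s : ℝ)

/-- The tower of averages that represents `ζ`. -/
noncomputable abbrev ζTower : ℕ → ℝ → (Fin l × Fin l → ℝ) → ℝ :=
  tower (layerVar m n p q) (layerCoeff x y) c fun _ => gibbsZ β s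

/-- The reweighted averages that represent `Φchain`. -/
noncomputable abbrev ζChain (b k : ℕ) (f : ℝ → (Fin l × Fin l → ℝ) → ℝ) :
    ℝ → (Fin l × Fin l → ℝ) → ℝ :=
  tiltChain (layerVar m n p q) (layerCoeff x y) c (fun _ => gibbsZ β s) b k f

lemma C_eq (r : ℕ) (t : ℝ) (i₁ : Fin l) (ω : Sample m n) :
    C r x y β t i₁ ω = gibbsC β i₁ (tailField x y r t 0 ω) := by
  simp only [C, A, gibbsC, D₀_eq_tailField]

lemma Z_eq (r : ℕ) (t : ℝ) (ω : Sample m n) :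
    Z r x y β s t ω = gibbsZ β s (tailField x y r t 0 ω) := by
  simp only [Z, gibbsZ, C_eq]

/-- The sample enters `ζ_k` only through the field of the layers after `k`, so `ζ_k` is a function
of `(t, v)`. -/
lemma ζ_eq {r k : ℕ} (hk : k ≤ r) (t : ℝ) :
    ζ r x y p q c β s t k = fun ω : Sample m n =>
      ζTower x y p q c β s k t (tailField x y r t k ω) := by
  induction k with
  | zero => funext ω; exact Z_eq x y β s r t ω
  | succ k ih =>
    funext ω
    rw [ζ, ih (by omega)]
    exact layerExp_tailField x y p q (by omega)
      (fun t v => ζTower x y p q c β s k t v ^ (c (k + 1) / c k)) t ω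

lemma Φ_eq {r k : ℕ} (hk : k < r) (t : ℝ) (f : ℝ → (Fin l × Fin l → ℝ) → ℝ) :
    Φ r x y p q c β s t (k + 1) (fun ω => f t (tailField x y r t k ω))
      = fun ω => tiltStep (layerVar m n p q) (layerCoeff x y) c (fun _ => gibbsZ β s) k f t
          (tailField x y r t (k + 1) ω) := by
  funext ω
  have h := layerExp_tailField x y p q hk.le
    (fun t v => ζTower x y p q c β s k t v ^ (c (k + 1) / c k) * f t v) t ω
  rw [tiltStep, tilt, ← h, Φ, layerExp, layerExp, ← integral_div]
  refine integral_congr_ae (ae_of_all _ fun u => ?_)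
  simp only [ζ_eq x y p q c β s hk.le, ζ_eq x y p q c β s (show k + 1 ≤ r from hk),
    Nat.add_sub_cancel, tailField_succ_update]
  rw [div_mul_eq_mul_div]
  rfl

lemma Φchain_eq {r b k : ℕ} (hb : 1 ≤ b) (hbk : b ≤ k + 1) (hk : k ≤ r) (t : ℝ)
    (f : ℝ → (Fin l × Fin l → ℝ) → ℝ) :
    Φchain r x y p q c β s t b k (fun ω => f t (tailField x y r t (b - 1) ω))
      = fun ω => ζChain x y p q c β s b k f t (tailField x y r t k ω) := by
  induction k with
  | zero =>
    obtain rfl : b = 1 := by omega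
    rfl
  | succ k ih =>
    rw [Φchain]
    split_ifs with h
    · rw [ih h (by omega), Φ_eq x y p q c β s hk]
      simp only [tiltChain, if_pos h]
    -- An empty chain: the function is already read at level `b - 1 = k + 1`.
    · obtain rfl : b = k + 2 := by omega
      simp only [tiltChain, if_neg h]
      rfl

lemma γ₀_eq (r : ℕ) (t : ℝ) (i₁ i₂ : Fin l) :
    γ₀ r x y β s t i₁ i₂ = fun ω : Sample m n =>
      gibbsWeight β s (i₁, i₂) (tailField x y r t 0 ω) := by
  funext ω
  simp only [γ₀, gibbsWeight, A, D₀_eq_tailField, Z_eq, C_eq]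

lemma γ₀₁_eq (r : ℕ) (t : ℝ) (i₁ i₂ : Fin l) :
    γ₀₁ r x y p q c β s t i₁ i₂ = fun ω : Sample m n =>
      ζChain x y p q c β s 1 r (fun _ => gibbsWeight β s (i₁, i₂)) t
        (tailField x y r t r ω) := by
  rw [γ₀₁, γ₀_eq]
  exact Φchain_eq x y p q c β s le_rfl (by omega) le_rfl t fun _ => gibbsWeight β s (i₁, i₂)

lemma γ₀₂_eq (r : ℕ) (t : ℝ) (i₁ i₂ p₂ : Fin l) :
    γ₀₂ r x y p q c β s t i₁ i₂ p₂ = fun ω : Sample m n =>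
      ζChain x y p q c β s 1 r (fun _ => gibbsPairWeight β s i₁ i₂ p₂) t
        (tailField x y r t r ω) := by
  rw [γ₀₂]
  simp only [A, D₀_eq_tailField, Z_eq, C_eq]
  exact Φchain_eq x y p q c β s le_rfl (by omega) le_rfl t
    fun _ => gibbsPairWeight β s i₁ i₂ p₂

lemma γ_eq {r k : ℕ} (hk : 1 ≤ k) (hkr : k ≤ r + 1) (t : ℝ) (i₁ i₂ p₁ p₂ : Fin l) :
    γ r x y p q c β s t k i₁ i₂ p₁ p₂ = fun ω : Sample m n =>
      ζChain x y p q c β s k r (fun t v =>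
        ζChain x y p q c β s 1 (k - 1) (fun _ => gibbsWeight β s (i₁, i₂)) t v
          * ζChain x y p q c β s 1 (k - 1) (fun _ => gibbsWeight β s (p₁, p₂)) t v) t
        (tailField x y r t r ω) := by
  have h : ∀ i : Fin l × Fin l, Φchain r x y p q c β s t 1 (k - 1) (γ₀ r x y β s t i.1 i.2)
      = fun ω => ζChain x y p q c β s 1 (k - 1) (fun _ => gibbsWeight β s i) t
          (tailField x y r t (k - 1) ω) := fun i => by
    rw [γ₀_eq]
    exact Φchain_eq x y p q c β s le_rfl (by omega) (by omega) t fun _ => gibbsWeight β s i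
  rw [γ, h (i₁, i₂), h (p₁, p₂)]
  exact Φchain_eq x y p q c β s hk hkr le_rfl t fun t v =>
        ζChain x y p q c β s 1 (k - 1) (fun _ => gibbsWeight β s (i₁, i₂)) t v
          * ζChain x y p q c β s 1 (k - 1) (fun _ => gibbsWeight β s (p₁, p₂)) t v

end Bridge

/-! ### The partition function and its first two derivatives. -/

section Gibbs

variable {l : ℕ} {S : Set ℝ} (β s : ℝ)

lemma posTame_gibbsC [NeZero l] (S : Set ℝ) (i₁ : Fin l) : PosTame S fun _ => gibbsC β i₁ :=
  PosTame.sum Finset.univ_nonempty fun i₂ _ => PosTame.exp_coord S β (i₁, i₂)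

lemma posTame_gibbsZ [NeZero l] (S : Set ℝ) :
    PosTame S fun _ => gibbsZ (l := l) β s :=
  PosTame.sum Finset.univ_nonempty fun i₁ _ => (posTame_gibbsC β S i₁).rpow s

lemma posTame_gibbsWeight [NeZero l] (S : Set ℝ) (i : Fin l × Fin l) :
    PosTame S fun _ => gibbsWeight β s i :=
  (((posTame_gibbsC β S i.1).rpow s).div (posTame_gibbsZ β s S)).mul
    ((PosTame.exp_coord S β i).div (posTame_gibbsC β S i.1))

lemma posTame_gibbsPairWeight [NeZero l] (S : Set ℝ) (i₁ i₂ p₂ : Fin l) :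
    PosTame S fun _ => gibbsPairWeight β s i₁ i₂ p₂ :=
  (posTame_gibbsWeight β s S (i₁, i₂)).mul
    ((PosTame.exp_coord S β (i₁, p₂)).div (posTame_gibbsC β S i₁))

lemma gibbsC_pos [NeZero l] (i₁ : Fin l) (v : Fin l × Fin l → ℝ) : 0 < gibbsC β i₁ v :=
  (posTame_gibbsC β Set.univ i₁).pos 0 trivial v

lemma gibbsZ_pos [NeZero l] (v : Fin l × Fin l → ℝ) : 0 < gibbsZ β s v :=
  (posTame_gibbsZ β s Set.univ).pos 0 trivial v

lemma hasFDerivAt_exp_coord (i : Fin l × Fin l) (v : Fin l × Fin l → ℝ) :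
    HasFDerivAt (fun v : Fin l × Fin l → ℝ => Real.exp (β * v i))
      ((Real.exp (β * v i) * β) • (ContinuousLinearMap.proj i : (Fin l × Fin l → ℝ) →L[ℝ] ℝ))
      v := by
  refine (((hasFDerivAt_apply i v).const_mul β).exp).congr_fderiv ?_
  rw [smul_smul]

lemma hasFDerivAt_gibbsC (i₁ : Fin l) (v : Fin l × Fin l → ℝ) :
    HasFDerivAt (gibbsC β i₁) (∑ i₂, (Real.exp (β * v (i₁, i₂)) * β) •
      (ContinuousLinearMap.proj (i₁, i₂) : (Fin l × Fin l → ℝ) →L[ℝ] ℝ)) v :=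
  HasFDerivAt.fun_sum fun i₂ _ => hasFDerivAt_exp_coord β (i₁, i₂) v

/-- The logarithmic gradient of `gibbsZ`. -/
noncomputable def gibbsGrad (i : Fin l × Fin l) (_ : ℝ) (v : Fin l × Fin l → ℝ) : ℝ :=
  s * β * gibbsWeight β s i v

/-- The Hessian of `gibbsZ` divided by `gibbsZ`. -/
noncomputable def gibbsHess (i j : Fin l × Fin l) (_ : ℝ) (v : Fin l × Fin l → ℝ) : ℝ :=
  s * β ^ 2 * ((if i = j then gibbsWeight β s i v else 0)
    + (s - 1) * if i.1 = j.1 then gibbsPairWeight β s i.1 i.2 j.2 v else 0)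

/-- The denominator `Z` disappears, leaving a product that is simple to differentiate once more. -/
lemma gibbsZ_mul_gibbsGrad [NeZero l] (i : Fin l × Fin l) (t : ℝ) (v : Fin l × Fin l → ℝ) :
    gibbsZ β s v * gibbsGrad β s i t v
      = s * β * (gibbsC β i.1 v ^ (s - 1) * Real.exp (β * v i)) := by
  have h1 := (gibbsZ_pos β s v).ne'
  have h2 := gibbsC_pos β i.1 v
  rw [gibbsGrad, gibbsWeight, Real.rpow_sub_one h2.ne']
  field_simp

/-- With the field as variable there is no explicit time dependence. Differentiating the exponential
in `C ^ (s - 1) * exp (β v_i)` gives the diagonal part of the Hessian; differentiating the power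
gives the part with common first index, with the factor `s - 1`. -/
lemma isLogJet_gibbsZ [NeZero l] (S : Set ℝ) :
    IsLogJet S 1 (fun _ => gibbsZ (l := l) β s) (fun _ _ => 0) (gibbsGrad β s)
      (gibbsHess β s) := by
  refine ⟨posTame_gibbsZ β s S, Tame.const S 0,
    fun i => (posTame_gibbsWeight β s S i).tame.const_mul _, fun i j => ?_,
    fun t _ v => ?_, fun t _ v i => ?_⟩
  · refine Tame.const_mul _ (Tame.add ?_ (Tame.const_mul _ ?_))
    · by_cases h : i = j
      · simpa only [h, if_true] using (posTame_gibbsWeight β s S j).tame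
      · simpa only [h, if_false] using Tame.const S 0
    · by_cases h : i.1 = j.1
      · simpa only [h, if_true] using (posTame_gibbsPairWeight β s S j.1 i.2 j.2).tame
      · simpa only [h, if_false] using Tame.const S 0
  · have h1 : HasFDerivAt (gibbsZ β s) (∑ i₁, (s * gibbsC β i₁ v ^ (s - 1)) •
        ∑ i₂, (Real.exp (β * v (i₁, i₂)) * β) •
          (ContinuousLinearMap.proj (i₁, i₂) : (Fin l × Fin l → ℝ) →L[ℝ] ℝ)) v :=
      HasFDerivAt.fun_sum fun i₁ _ => (hasFDerivAt_gibbsC β i₁ v).rpow_const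
        (Or.inl (gibbsC_pos β i₁ v).ne')
    refine (HasFDerivAt.comp (g := gibbsZ β s) (t, v) h1 hasFDerivAt_snd).congr_fderiv ?_
    refine ContinuousLinearMap.ext fun w => ?_
    simp only [ContinuousLinearMap.comp_apply, ContinuousLinearMap.coe_snd', sum_apply,
      smul_apply, ContinuousLinearMap.proj_apply, smul_eq_mul, timeSpaceForm_apply, one_mul,
      mul_zero, zero_mul, zero_add, gibbsZ_mul_gibbsGrad, Fintype.sum_prod_type, Finset.mul_sum]
    exact Finset.sum_congr rfl fun i₁ _ => Finset.sum_congr rfl fun i₂ _ => by ring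
  · simp only [gibbsZ_mul_gibbsGrad]
    refine ((((hasFDerivAt_gibbsC β i.1 v).rpow_const (p := s - 1)
      (Or.inl (gibbsC_pos β i.1 v).ne')).mul
        (hasFDerivAt_exp_coord β i v)).const_mul (s * β)).congr_fderiv ?_
    refine ContinuousLinearMap.ext fun w => ?_
    have hZ := (gibbsZ_pos β s v).ne'
    have hC := gibbsC_pos β i.1 v
    simp only [add_apply, sum_apply, smul_apply, ContinuousLinearMap.proj_apply, smul_eq_mul,
      spaceForm_apply, gibbsHess, mul_add, add_mul, Finset.sum_add_distrib, mul_ite, ite_mul,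
      mul_zero, zero_mul, Finset.sum_ite_eq, Finset.mem_univ, if_true]
    congr 1
    · rw [gibbsWeight, Real.rpow_sub_one hC.ne']
      field_simp
    · rw [Fintype.sum_prod_type, Finset.sum_comm]
      simp only [Finset.sum_ite_eq, Finset.mem_univ, if_true, Finset.mul_sum]
      refine Finset.sum_congr rfl fun k _ => ?_
      rw [gibbsPairWeight, Real.rpow_sub_one hC.ne', Real.rpow_sub_one hC.ne']
      field_simp

end Gibbs

/-! ### Time-dependent coefficients and their covariances. -/

section Coefficients

variable {m n l : ℕ} (x : Fin l → EuclideanSpace ℝ (Fin n)) (y : Fin l → EuclideanSpace ℝ (Fin m))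

lemma smoothCoeff_phase_mul {I J : Type*} [Fintype I] [Fintype J] {S : Set ℝ} (hS : IsOpen S)
    {φ φ' : J → ℝ → ℝ} (hφ : ∀ j, ∀ t ∈ S, HasDerivAt (φ j) (φ' j t) t) {K : ℝ} (hK : 0 ≤ K)
    (hb : ∀ j, ∀ t ∈ S, |φ j t| ≤ K ∧ |φ' j t| ≤ K) (b : J → I → ℝ) :
    SmoothCoeff S (fun j i t => φ j t * b j i) (fun j i t => φ' j t * b j i) := by
  refine ⟨hS, fun j i t ht => (hφ j t ht).mul_const _, K * ∑ j, ∑ i, |b j i|,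
    mul_nonneg hK (Finset.sum_nonneg fun j _ => Finset.sum_nonneg fun i _ => abs_nonneg _),
    fun j i t ht => ?_⟩
  have h : |b j i| ≤ ∑ j, ∑ i, |b j i| :=
    (Finset.single_le_sum (f := fun i => |b j i|) (fun i _ => abs_nonneg _)
      (Finset.mem_univ i)).trans
      (Finset.single_le_sum (f := fun j => ∑ i, |b j i|)
        (fun j _ => Finset.sum_nonneg fun i _ => abs_nonneg _) (Finset.mem_univ j))
  rw [abs_mul, abs_mul]
  exact ⟨mul_le_mul (hb j t ht).1 h (abs_nonneg _) hK,
    mul_le_mul (hb j t ht).2 h (abs_nonneg _) hK⟩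

lemma hasDerivAt_sqrt_one_sub {t : ℝ} (ht : t < 1) :
    HasDerivAt (fun t => √(1 - t)) (-(1 / (2 * √(1 - t)))) t := by
  refine (((hasDerivAt_id t).const_sub 1).sqrt (by simp; linarith)).congr_deriv ?_
  simp [neg_div]

lemma abs_sqrt_le_one {u : ℝ} (h : u ≤ 1) : |√u| ≤ 1 := by
  rw [abs_of_nonneg (Real.sqrt_nonneg u)]
  exact Real.sqrt_le_one.2 h

lemma abs_inv_sqrt_le {δ u : ℝ} (hδ : 0 < δ) (h : δ ≤ u) :
    |1 / (2 * √u)| ≤ 1 / (2 * √δ) := by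
  have := Real.sqrt_pos.2 hδ
  rw [abs_of_nonneg (by positivity)]
  gcongr

/-- The derivatives of `√t` and `√(1 - t)` blow up at the endpoints, hence the margin `δ`. -/
lemma layerPhase_bounds {δ : ℝ} (hδ : 0 < δ) (j : LayerIdx m n) {t : ℝ}
    (ht : t ∈ Set.Ioo δ (1 - δ)) :
    HasDerivAt (layerPhase j) (layerPhaseDeriv j t) t ∧
      |layerPhase j t| ≤ 1 + 1 / (2 * √δ) ∧ |layerPhaseDeriv j t| ≤ 1 + 1 / (2 * √δ) := by
  obtain ⟨h1, h2⟩ := ht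
  have h3 : 0 ≤ 1 / (2 * √δ) := by positivity
  rcases j with j | j
  · refine ⟨Real.hasDerivAt_sqrt (by linarith), ?_, ?_⟩
    · exact (abs_sqrt_le_one (by linarith)).trans (by linarith)
    · exact (abs_inv_sqrt_le hδ h1.le).trans (by linarith)
  · refine ⟨hasDerivAt_sqrt_one_sub (by linarith), ?_, ?_⟩
    · exact (abs_sqrt_le_one (by linarith)).trans (by linarith)
    · show |-(1 / (2 * √(1 - t)))| ≤ _
      rw [abs_neg]
      exact (abs_inv_sqrt_le hδ (by linarith)).trans (by linarith)

lemma smoothCoeff_layerCoeff {δ : ℝ} (hδ : 0 < δ) :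
    SmoothCoeff (Set.Ioo δ (1 - δ)) (layerCoeff x y)
      (fun j i t => layerPhaseDeriv j t * layerWeight x y j i) :=
  smoothCoeff_phase_mul isOpen_Ioo (fun j _ ht => (layerPhase_bounds hδ j ht).1)
    (K := 1 + 1 / (2 * √δ)) (by positivity) (fun j _ ht => (layerPhase_bounds hδ j ht).2) _

lemma smoothCoeff_outerCoeff {δ : ℝ} (hδ : 0 < δ) :
    SmoothCoeff (Set.Ioo δ (1 - δ)) (outerCoeff x y)
      (fun j i t => outerPhaseDeriv j t * outerWeight x y j i) := by
  have h : ∀ (j : (Fin m × Fin n) ⊕ LayerIdx m n) (t : ℝ), t ∈ Set.Ioo δ (1 - δ) →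
      HasDerivAt (outerPhase j) (outerPhaseDeriv j t) t ∧
      |outerPhase j t| ≤ 1 + 1 / (2 * √δ) ∧ |outerPhaseDeriv j t| ≤ 1 + 1 / (2 * √δ) := by
    rintro (j | j) t ht
    · exact layerPhase_bounds (m := m) (n := n) hδ (Sum.inl ()) ht
    · exact layerPhase_bounds hδ j ht
  exact smoothCoeff_phase_mul isOpen_Ioo (fun j t ht => (h j t ht).1)
    (K := 1 + 1 / (2 * √δ)) (by positivity) (fun j t ht => (h j t ht).2) _

/-- Half the overlap kernel of level `k`. -/
noncomputable def overlapKernel (p q : ℕ → ℝ) (k : ℕ) (i j : Fin l × Fin l) : ℝ :=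
  1 / 2 * ((p k * (‖x i.1‖ * ‖x j.1‖) - inner ℝ (x j.1) (x i.1))
    * (q k * (‖y i.2‖ * ‖y j.2‖) - inner ℝ (y j.2) (y i.2)))

lemma inner_eq_sum {d : ℕ} (u w : EuclideanSpace ℝ (Fin d)) : inner ℝ w u = ∑ a, u a * w a := by
  simp [PiLp.inner_apply]

/-- Half the derivative of the squared phase, `t` or `1 - t`; the time dependence drops out of the
covariances. -/
lemma phaseDeriv_mul_phase {t : ℝ} (h0 : 0 < t) (h1 : t < 1) (j : LayerIdx m n) :
    layerPhaseDeriv j t * layerPhase j t = Sum.elim (fun _ => 1 / 2) (fun _ => -(1 / 2)) j := by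
  have e0 := (Real.sqrt_pos.2 h0).ne'
  have e1 := (Real.sqrt_pos.2 (sub_pos.2 h1)).ne'
  rcases j with j | j <;> simp only [layerPhaseDeriv, layerPhase, Sum.elim_inl, Sum.elim_inr] <;>
    field_simp

/-- The variances are chosen for this telescoping: expanding the product in the kernel, the `p q`
term comes from `u⁽⁴⁾`, the mixed terms from `u⁽²⁾` and `h` with the opposite sign, and the product
of inner products does not depend on the level. Monotonicity and nonnegativity make the truncated
variances the true ones. -/
lemma layer_covariance {p q : ℕ → ℝ} {k : ℕ} (hp : p (k + 1) ≤ p k) (hq : q (k + 1) ≤ q k)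
    (hp0 : 0 ≤ p (k + 1)) (hq0 : 0 ≤ q (k + 1)) {t : ℝ} (h0 : 0 < t) (h1 : t < 1)
    (i j : Fin l × Fin l) :
    ∑ a, layerVar m n p q (k + 1) a * (layerPhaseDeriv a t * layerWeight x y a i)
        * layerCoeff x y a j t
      = overlapKernel x y p q k i j - overlapKernel x y p q (k + 1) i j := by
  have e : ∀ a : LayerIdx m n, layerVar m n p q (k + 1) a
      * (layerPhaseDeriv a t * layerWeight x y a i) * layerCoeff x y a j t
      = layerVar m n p q (k + 1) a * Sum.elim (fun _ => 1 / 2) (fun _ => -(1 / 2)) a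
        * (layerWeight x y a i * layerWeight x y a j) := fun a => by
    rw [← phaseDeriv_mul_phase h0 h1 a, layerCoeff]; ring
  have hpq : 0 ≤ p k * q k - p (k + 1) * q (k + 1) := by nlinarith
  rw [Finset.sum_congr rfl fun a _ => e a]
  simp only [Fintype.sum_sum_type, layerVar, layerWeight, Sum.elim_inl, Sum.elim_inr,
    Nat.add_sub_cancel, Real.coe_toNNReal _ hpq, Real.coe_toNNReal _ (sub_nonneg.2 hp),
    Real.coe_toNNReal _ (sub_nonneg.2 hq), overlapKernel, Finset.univ_unique,
    Finset.sum_singleton]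
  have ey : ∑ a, (p k - p (k + 1)) * -(1 / 2) * (‖x i.1‖ * y i.2 a * (‖x j.1‖ * y j.2 a))
      = (p k - p (k + 1)) * -(1 / 2) * (‖x i.1‖ * ‖x j.1‖) * inner ℝ (y j.2) (y i.2) := by
    rw [inner_eq_sum, Finset.mul_sum]
    exact Finset.sum_congr rfl fun a _ => by ring
  have ex : ∑ b, (q k - q (k + 1)) * -(1 / 2) * (‖y i.2‖ * x i.1 b * (‖y j.2‖ * x j.1 b))
      = (q k - q (k + 1)) * -(1 / 2) * (‖y i.2‖ * ‖y j.2‖) * inner ℝ (x j.1) (x i.1) := by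
    rw [inner_eq_sum, Finset.mul_sum]
    exact Finset.sum_congr rfl fun b _ => by ring
  rw [ey, ex]
  ring

/-- As `p` and `q` vanish at `r + 1`, the kernel there is half the product of the inner products,
which is what `G` contributes. It closes the telescoping sum. -/
lemma outer_covariance {p q : ℕ → ℝ} {r : ℕ} (hp : p (r + 1) ≤ p r) (hq : q (r + 1) ≤ q r)
    (hpr : p (r + 1) = 0) (hqr : q (r + 1) = 0) {t : ℝ} (h0 : 0 < t) (h1 : t < 1)
    (i j : Fin l × Fin l) :
    ∑ a, outerVar m n p q (r + 1) a * (outerPhaseDeriv a t * outerWeight x y a i)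
        * outerCoeff x y a j t
      = overlapKernel x y p q r i j := by
  have h := layer_covariance x y hp hq hpr.ge hqr.ge h0 h1 i j
  rw [Fintype.sum_sum_type]
  simp only [outerCoeff, outerVar, outerPhaseDeriv, outerPhase, outerWeight, Sum.elim_inl,
    Sum.elim_inr]
  simp only [layerCoeff] at h
  rw [h, overlapKernel, overlapKernel, hpr, hqr, Fintype.sum_prod_type]
  have e0 := (Real.sqrt_pos.2 h0).ne'
  have eG : ∑ a, ∑ b, ((1 : NNReal) : ℝ) * (1 / (2 * √t) * (y i.2 a * x i.1 b))
      * (√t * (y j.2 a * x j.1 b))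
      = 1 / 2 * (inner ℝ (x j.1) (x i.1) * inner ℝ (y j.2) (y i.2)) := by
    rw [inner_eq_sum, inner_eq_sum, mul_comm (∑ b, _), Finset.sum_mul_sum, Finset.mul_sum]
    refine Finset.sum_congr rfl fun a _ => ?_
    rw [Finset.mul_sum]
    refine Finset.sum_congr rfl fun b _ => ?_
    rw [NNReal.coe_one]
    field_simp
  rw [eG]
  ring

end Coefficients

/-! ### The abstract derivative rewritten in terms of the `φ`. -/

section Derivative

variable {m n l : ℕ} (x : Fin l → EuclideanSpace ℝ (Fin n)) (y : Fin l → EuclideanSpace ℝ (Fin m))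
  (p q c : ℕ → ℝ) (β s : ℝ)

lemma nonneg_of_antitone {u : ℕ → ℝ} {r : ℕ} (hu : ∀ k ≤ r, u (k + 1) ≤ u k)
    (hr : u (r + 1) = 0) {k : ℕ} (hk : k ≤ r + 1) : 0 ≤ u k := by
  induction hk using Nat.decreasingInduction with
  | of_succ k hk ih => exact ih.trans (hu k (by omega))
  | self => exact hr.ge

/-- The sum over pairs of configurations that is averaged in `φ`. -/
noncomputable def pairSum (r k : ℕ) (t : ℝ) (v : Fin l × Fin l → ℝ) : ℝ :=
  ∑ w : (Fin l × Fin l) × (Fin l × Fin l), 2 * overlapKernel x y p q (k - 1) w.1 w.2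
    * ζChain x y p q c β s k r (fun t v =>
        ζChain x y p q c β s 1 (k - 1) (fun _ => gibbsWeight β s w.1) t v
          * ζChain x y p q c β s 1 (k - 1) (fun _ => gibbsWeight β s w.2) t v) t v

/-- The sum that is averaged in `φ₀₁`. -/
noncomputable def diagSum (r : ℕ) (t : ℝ) (v : Fin l × Fin l → ℝ) : ℝ :=
  ∑ i : Fin l × Fin l, ‖x i.1‖ ^ 2 * ‖y i.2‖ ^ 2
    * ζChain x y p q c β s 1 r (fun _ => gibbsWeight β s i) t v

/-- The sum that is averaged in `φ₀₂`. -/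
noncomputable def semidiagSum (r : ℕ) (t : ℝ) (v : Fin l × Fin l → ℝ) : ℝ :=
  ∑ w : (Fin l × Fin l) × Fin l,
    ‖x w.1.1‖ ^ 2 * (q 0 * (‖y w.1.2‖ * ‖y w.2‖) - inner ℝ (y w.2) (y w.1.2))
      * ζChain x y p q c β s 1 r (fun _ => gibbsPairWeight β s w.1.1 w.1.2 w.2) t v

lemma φ_eq {r k : ℕ} (hk : 1 ≤ k) (hkr : k ≤ r + 1) (t : ℝ) :
    φ r x y p q c β s t k = -s * (c (k - 1) - c k)
      * avg (outerVar m n p q (r + 1)) (outerCoeff x y) (pairSum x y p q c β s r k) t 0 := by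
  rw [φ, ← outerExp_tailField]
  congr 2
  funext ω
  simp only [pairSum, Fintype.sum_prod_type, γ_eq x y p q c β s hk hkr]
  refine Finset.sum_congr rfl fun i₁ _ => Finset.sum_congr rfl fun i₂ _ =>
    Finset.sum_congr rfl fun p₁ _ => Finset.sum_congr rfl fun p₂ _ => ?_
  rw [overlapKernel]
  ring

lemma φ₀₁_eq (r : ℕ) (t : ℝ) :
    φ₀₁ r x y p q c β s t = (1 - p 0) * (1 - q 0)
      * avg (outerVar m n p q (r + 1)) (outerCoeff x y) (diagSum x y p q c β s r) t 0 := by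
  rw [φ₀₁, ← outerExp_tailField]
  congr 2
  funext ω
  simp only [diagSum, Fintype.sum_prod_type, γ₀₁_eq x y p q c β s]

lemma φ₀₂_eq (r : ℕ) (t : ℝ) :
    φ₀₂ r x y p q c β s t = -(s - 1) * (1 - p 0)
      * avg (outerVar m n p q (r + 1)) (outerCoeff x y) (semidiagSum x y p q c β s r) t 0 := by
  rw [φ₀₂, ← outerExp_tailField]
  congr 2
  funext ω
  simp only [semidiagSum, Fintype.sum_prod_type, γ₀₂_eq x y p q c β s]

/-- On the diagonal both factors of the kernel reduce to multiples of `p 0 - 1` and `q 0 - 1`; with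
only the first index shared, just the first factor does. The sum type keeps both kinds of terms in
one linear combination, to which linearity of the chains applies. -/
lemma sum_overlapKernel_gibbsHess (t : ℝ) (v : Fin l × Fin l → ℝ) :
    ∑ i, ∑ j, overlapKernel x y p q 0 i j * gibbsHess β s i j t v
      = ∑ w : (Fin l × Fin l) ⊕ ((Fin l × Fin l) × Fin l), s * β ^ 2 / 2 *
        Sum.elim (fun i => (1 - p 0) * (1 - q 0) * (‖x i.1‖ ^ 2 * ‖y i.2‖ ^ 2))
          (fun w => -(s - 1) * (1 - p 0) * (‖x w.1.1‖ ^ 2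
            * (q 0 * (‖y w.1.2‖ * ‖y w.2‖) - inner ℝ (y w.2) (y w.1.2)))) w
        * (Sum.elim (fun i => gibbsWeight β s i)
          (fun w => gibbsPairWeight β s w.1.1 w.1.2 w.2) w : (Fin l × Fin l → ℝ) → ℝ) v := by
  rw [Fintype.sum_sum_type, Fintype.sum_prod_type (f := fun w : (Fin l × Fin l) × Fin l => _),
    ← Finset.sum_add_distrib]
  refine Finset.sum_congr rfl fun i _ => ?_
  simp only [gibbsHess, mul_add, Finset.sum_add_distrib, mul_ite, mul_zero, Finset.sum_ite_eq,
    Finset.mem_univ, if_true, Sum.elim_inl, Sum.elim_inr]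
  congr 1
  · rw [overlapKernel, real_inner_self_eq_norm_sq, real_inner_self_eq_norm_sq]
    ring
  · rw [Fintype.sum_prod_type, Finset.sum_comm]
    refine Finset.sum_congr rfl fun k _ => ?_
    rw [Finset.sum_ite_eq, if_pos (Finset.mem_univ _), overlapKernel,
      real_inner_self_eq_norm_sq]
    ring

variable {S : Set ℝ} {a' : LayerIdx m n → Fin l × Fin l → ℝ → ℝ} [NeZero l]

/-- The Hessian gives the first two sums. Each overlap term carries `(s β) ^ 2` from the two
gradients, which splits as the common factor `s β² / 2`, the `s` in `φ`, and the `2` undoing the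
half in the kernel. -/
lemma totalTerm_gibbs (ha : SmoothCoeff S (layerCoeff x y) a') (r : ℕ) {t : ℝ} (ht : t ∈ S)
    (v : Fin l × Fin l → ℝ) :
    totalTerm (layerVar m n p q) (layerCoeff x y) c (fun _ => gibbsZ β s)
        (overlapKernel x y p q) (gibbsGrad β s)
        (fun t v => 0 + ∑ i, ∑ j, overlapKernel x y p q 0 i j * gibbsHess β s i j t v)
        (r + 1) r t v
      = s * β ^ 2 / 2 * ((1 - p 0) * (1 - q 0) * diagSum x y p q c β s r t v)
        + s * β ^ 2 / 2 * (-(s - 1) * (1 - p 0) * semidiagSum x y p q c β s r t v)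
        + ∑ k ∈ Finset.Icc 1 (r + 1),
          s * β ^ 2 / 2 * (-s * (c (k - 1) - c k) * pairSum x y p q c β s r k t v) := by
  have hZ := posTame_gibbsZ (l := l) β s S
  have hw : ∀ i : Fin l × Fin l, Tame S fun _ => gibbsWeight β s i := fun i => (posTame_gibbsWeight β s S i).tame
  rw [totalTerm, sub_eq_add_neg, ← Finset.sum_neg_distrib]
  congr 1
  · simp only [zero_add, sum_overlapKernel_gibbsHess]
    rw [tiltChain_linear ha hZ 1 r (fun w : (Fin l × Fin l) ⊕ ((Fin l × Fin l) × Fin l) =>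
      s * β ^ 2 / 2 *
        Sum.elim (fun i => (1 - p 0) * (1 - q 0) * (‖x i.1‖ ^ 2 * ‖y i.2‖ ^ 2))
          (fun w => -(s - 1) * (1 - p 0) * (‖x w.1.1‖ ^ 2
            * (q 0 * (‖y w.1.2‖ * ‖y w.2‖) - inner ℝ (y w.2) (y w.1.2)))) w)
      (F := fun w _ => (Sum.elim (fun i => gibbsWeight β s i)
          (fun w => gibbsPairWeight β s w.1.1 w.1.2 w.2) w : (Fin l × Fin l → ℝ) → ℝ))
      (by
        rintro (i | w)
        · exact hw i
        · exact (posTame_gibbsPairWeight β s S w.1.1 w.1.2 w.2).tame) ht v]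
    rw [Fintype.sum_sum_type, diagSum, semidiagSum]
    simp only [Sum.elim_inl, Sum.elim_inr, Finset.mul_sum]
    congr 1 <;> exact Finset.sum_congr rfl fun i _ => by ring
  · refine Finset.sum_congr rfl fun k hk => ?_
    obtain ⟨k, rfl⟩ := Nat.exists_eq_add_of_le' (Finset.mem_Icc.1 hk).1
    simp only [Nat.add_sub_cancel]
    have h1 : overlapTerm (layerVar m n p q) (layerCoeff x y) c (fun _ => gibbsZ β s)
        (overlapKernel x y p q) (gibbsGrad β s) k
        = fun t v => ∑ w : (Fin l × Fin l) × (Fin l × Fin l),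
          (overlapKernel x y p q k w.1 w.2 * ((c k - c (k + 1)) * (s * β) ^ 2))
          * (ζChain x y p q c β s 1 k (fun _ => gibbsWeight β s w.1) t v
            * ζChain x y p q c β s 1 k (fun _ => gibbsWeight β s w.2) t v) := by
      funext t v
      have h2 : ∀ i, tiltChain (layerVar m n p q) (layerCoeff x y) c (fun _ => gibbsZ β s) 1 k
          (gibbsGrad β s i) t v
          = s * β * ζChain x y p q c β s 1 k (fun _ => gibbsWeight β s i) t v :=
        fun i => tiltChain_const_mul 1 k (s * β) (f := fun _ => gibbsWeight β s i) t v
      rw [overlapTerm,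
        Fintype.sum_prod_type (f := fun w : (Fin l × Fin l) × (Fin l × Fin l) => _)]
      refine Finset.sum_congr rfl fun i _ => Finset.sum_congr rfl fun j _ => ?_
      rw [h2, h2]
      ring
    rw [h1, tiltChain_linear ha hZ (k + 1) r
      (fun w : (Fin l × Fin l) × (Fin l × Fin l) =>
        overlapKernel x y p q k w.1 w.2 * ((c k - c (k + 1)) * (s * β) ^ 2))
      (F := fun w t v => ζChain x y p q c β s 1 k (fun _ => gibbsWeight β s w.1) t v
            * ζChain x y p q c β s 1 k (fun _ => gibbsWeight β s w.2) t v)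
      (fun w => (tame_tiltChain ha hZ 1 k (hw w.1)).mul (tame_tiltChain ha hZ 1 k (hw w.2))) ht v,
      pairSum, ← Finset.sum_neg_distrib, Finset.mul_sum, Finset.mul_sum]
    refine Finset.sum_congr rfl fun w _ => ?_
    simp only [Nat.add_sub_cancel]
    ring

lemma avg_totalTerm_gibbs (ha : SmoothCoeff S (layerCoeff x y) a')
    {α' : (Fin m × Fin n) ⊕ LayerIdx m n → Fin l × Fin l → ℝ → ℝ}
    (hα : SmoothCoeff S (outerCoeff x y) α') (r : ℕ) {t : ℝ} (ht : t ∈ S) :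
    avg (outerVar m n p q (r + 1)) (outerCoeff x y)
      (totalTerm (layerVar m n p q) (layerCoeff x y) c (fun _ => gibbsZ β s)
        (overlapKernel x y p q) (gibbsGrad β s)
        (fun t v => 0 + ∑ i, ∑ j, overlapKernel x y p q 0 i j * gibbsHess β s i j t v)
        (r + 1) r) t 0
      = s * β ^ 2 / 2 * ((∑ k ∈ Finset.Icc 1 (r + 1), φ r x y p q c β s t k)
        + φ₀₁ r x y p q c β s t + φ₀₂ r x y p q c β s t) := by
  have hZ := posTame_gibbsZ (l := l) β s S
  have hw : ∀ i : Fin l × Fin l, Tame S fun _ => gibbsWeight β s i := fun i => (posTame_gibbsWeight β s S i).tame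
  have t1 : Tame S (diagSum x y p q c β s r) :=
    Tame.sum fun i _ => (tame_tiltChain ha hZ 1 r (hw i)).const_mul _
  have t2 : Tame S (semidiagSum x y p q c β s r) :=
    Tame.sum fun w _ => (tame_tiltChain ha hZ 1 r
      (posTame_gibbsPairWeight β s S w.1.1 w.1.2 w.2).tame).const_mul _
  have t3 : ∀ k, Tame S (pairSum x y p q c β s r k) := fun k =>
    Tame.sum fun w _ => (tame_tiltChain ha hZ k r ((tame_tiltChain ha hZ 1 (k - 1) (hw w.1)).mul
      (tame_tiltChain ha hZ 1 (k - 1) (hw w.2)))).const_mul _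
  have hI : ∀ {f : ℝ → (Fin l × Fin l → ℝ) → ℝ}, Tame S f → ∀ a b : ℝ, Integrable
      (fun z => a * (b * f t (0 + linImage (outerCoeff x y) t z)))
      (gaussPi (outerVar m n p q (r + 1))) :=
    fun hf a b => ((hα.integrable _ hf ht 0).const_mul b).const_mul a
  have hφ : ∑ k ∈ Finset.Icc 1 (r + 1), φ r x y p q c β s t k
      = ∑ k ∈ Finset.Icc 1 (r + 1), -s * (c (k - 1) - c k)
      * avg (outerVar m n p q (r + 1)) (outerCoeff x y) (pairSum x y p q c β s r k) t 0 :=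
    Finset.sum_congr rfl fun k hk =>
      φ_eq x y p q c β s (Finset.mem_Icc.1 hk).1 (Finset.mem_Icc.1 hk).2 t
  rw [hφ, φ₀₁_eq, φ₀₂_eq]
  simp only [avg, totalTerm_gibbs x y p q c β s ha r ht]
  rw [integral_add (f := fun z => s * β ^ 2 / 2 * ((1 - p 0) * (1 - q 0)
        * diagSum x y p q c β s r t (0 + linImage (outerCoeff x y) t z))
        + s * β ^ 2 / 2 * (-(s - 1) * (1 - p 0)
          * semidiagSum x y p q c β s r t (0 + linImage (outerCoeff x y) t z)))
      ((hI t1 _ _).add (hI t2 _ _)) (integrable_finsetSum _ fun k _ => hI (t3 k) _ _),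
    integral_add (hI t1 _ _) (hI t2 _ _), integral_finsetSum _ fun k _ => hI (t3 k) _ _]
  simp only [integral_const_mul, ← Finset.mul_sum]
  ring

/-- Valid also when `β`, `s` or `N` vanishes, both sides then being `0` by the convention for
division. -/
lemma prefactor_eq (N : ℝ) :
    1 / (β * |s| * N) * (s * β ^ 2 / 2) = Real.sign s * β / (2 * N) := by
  rcases lt_trichotomy s 0 with h | rfl | h
  · rw [Real.sign_of_neg h, abs_of_neg h]
    rcases eq_or_ne β 0 with rfl | hβ
    · simp
    rcases eq_or_ne N 0 with rfl | hN
    · simp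
    have := h.ne
    field_simp
  · simp
  · rw [Real.sign_of_pos h, abs_of_pos h]
    rcases eq_or_ne β 0 with rfl | hβ
    · simp
    rcases eq_or_ne N 0 with rfl | hN
    · simp
    field_simp

omit [NeZero l] in
lemma ψ_eq (r : ℕ) (t : ℝ) :
    ψ r x y p q c β s t = 1 / (β * |s| * √n) * avg (outerVar m n p q (r + 1)) (outerCoeff x y)
      (fun t v => Real.log (ζTower x y p q c β s r t v) / c r) t 0 := by
  rw [ψ, avg, ← integral_const_mul]
  simp only [ζ_eq x y p q c β s le_rfl]
  refine (outerExp_tailField x y p q r (fun t v => 1 / (β * |s| * √n * c r)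
    * Real.log (ζTower x y p q c β s r t v)) t).trans ?_
  unfold avg
  refine integral_congr_ae (ae_of_all _ fun z => ?_)
  simp only [mul_inv, div_eq_mul_inv]
  ring

theorem hasDerivAt_ψ {r : ℕ} (hc0 : c 0 = 1) (hc : ∀ k, 1 ≤ k → k ≤ r → c k ≠ 0)
    (hcr : c (r + 1) = 0) (hp : ∀ k ≤ r, p (k + 1) ≤ p k) (hpr : p (r + 1) = 0)
    (hq : ∀ k ≤ r, q (k + 1) ≤ q k) (hqr : q (r + 1) = 0) {t : ℝ} (ht : t ∈ Set.Ioo (0 : ℝ) 1) :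
    HasDerivAt (fun τ => ψ r x y p q c β s τ)
      (Real.sign s * β / (2 * √(n : ℝ)) *
        ((∑ k ∈ Finset.Icc 1 (r + 1), φ r x y p q c β s t k)
          + φ₀₁ r x y p q c β s t + φ₀₂ r x y p q c β s t)) t := by
  -- Differentiability is local, so an interval around `t` away from `0` and `1` suffices.
  obtain ⟨δ, hδ, htδ⟩ : ∃ δ, 0 < δ ∧ t ∈ Set.Ioo δ (1 - δ) := by
    refine ⟨min t (1 - t) / 2, ?_, ?_, ?_⟩
    · have := lt_min ht.1 (sub_pos.2 ht.2); linarith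
    · linarith [min_le_left t (1 - t), ht.1]
    · linarith [min_le_right t (1 - t), ht.2]
  have ha := smoothCoeff_layerCoeff x y hδ
  have hα := smoothCoeff_outerCoeff x y hδ
  have hck : ∀ k ≤ r, c k ≠ 0 := fun k hk => by
    rcases Nat.eq_zero_or_pos k with rfl | h
    · rw [hc0]; exact one_ne_zero
    · exact hc k h hk
  have hT : ∀ τ ∈ Set.Ioo δ (1 - δ), 0 < τ ∧ τ < 1 := fun τ hτ =>
    ⟨hδ.trans hτ.1, by linarith [hτ.2]⟩
  have hW := isLogJet_gibbsZ (l := l) β s (Set.Ioo δ (1 - δ))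
  -- The second `1` is the exponent of the logarithmic jet; the first is the one in `1 - δ`.
  nth_rewrite 2 [← hc0] at hW
  have key := hasDerivAt_avg_log_tower (σ := layerVar m n p q)
    (σ' := outerVar m n p q (r + 1)) (κ := overlapKernel x y p q) ha hα hck hcr
    (fun k hk τ hτ i j => layer_covariance x y (hp k hk.le) (hq k hk.le)
      (nonneg_of_antitone hp hpr (by omega)) (nonneg_of_antitone hq hqr (by omega))
      (hT τ hτ).1 (hT τ hτ).2 i j)
    (fun τ hτ i j => outer_covariance x y (hp r le_rfl) (hq r le_rfl) hpr hqr
      (hT τ hτ).1 (hT τ hτ).2 i j)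
    hW htδ 0
  rw [avg_totalTerm_gibbs x y p q c β s ha hα r htδ] at key
  simp only [ψ_eq]
  refine (key.const_mul (1 / (β * |s| * √n))).congr_deriv ?_
  rw [← mul_assoc, prefactor_eq]

end Derivative

end FullLifting

theorem theorem3 (r : ℕ) (hr : 1 ≤ r) (m n l : ℕ)
    (x : Fin l → EuclideanSpace ℝ (Fin n)) (y : Fin l → EuclideanSpace ℝ (Fin m))
    (p q c : ℕ → ℝ)
    (hc0 : c 0 = 1) (hc : ∀ k, 1 ≤ k → k ≤ r → c k ≠ 0) (hcr : c (r + 1) = 0)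
    (hp0 : p 0 ≤ 1) (hp : ∀ k ≤ r, p (k + 1) ≤ p k) (hpr : p (r + 1) = 0)
    (hq0 : q 0 ≤ 1) (hq : ∀ k ≤ r, q (k + 1) ≤ q k) (hqr : q (r + 1) = 0)
    (β s : ℝ) (hβ : 0 ≤ β) (t : ℝ) (ht : t ∈ Set.Ioo (0 : ℝ) 1) :
    HasDerivAt (fun τ => FullLifting.ψ r x y p q c β s τ)
      (Real.sign s * β / (2 * √(n : ℝ)) *
        ((∑ k ∈ Finset.Icc 1 (r + 1), FullLifting.φ r x y p q c β s t k)
          + FullLifting.φ₀₁ r x y p q c β s t + FullLifting.φ₀₂ r x y p q c β s t)) t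
    ∧ (p 0 = 1 → q 0 = 1 →
      HasDerivAt (fun τ => FullLifting.ψ r x y p q c β s τ)
        (Real.sign s * β / (2 * √(n : ℝ)) *
          ∑ k ∈ Finset.Icc 1 (r + 1), FullLifting.φ r x y p q c β s t k) t) := by
  have main : HasDerivAt (fun τ => FullLifting.ψ r x y p q c β s τ)
      (Real.sign s * β / (2 * √(n : ℝ)) *
        ((∑ k ∈ Finset.Icc 1 (r + 1), FullLifting.φ r x y p q c β s t k)
          + FullLifting.φ₀₁ r x y p q c β s t + FullLifting.φ₀₂ r x y p q c β s t)) t := by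
    -- Without indices `Z` is an empty sum, not positive, and the jets are unavailable; but then `ψ`
    -- is constant in time and all `φ` vanish.
    rcases Nat.eq_zero_or_pos l with rfl | hl
    · have hφ : (∑ k ∈ Finset.Icc 1 (r + 1), FullLifting.φ r x y p q c β s t k)
          + FullLifting.φ₀₁ r x y p q c β s t + FullLifting.φ₀₂ r x y p q c β s t = 0 := by
        simp [FullLifting.φ, FullLifting.φ₀₁, FullLifting.φ₀₂, FullLifting.outerExp]
      have hζ : ∀ k τ, FullLifting.ζ r x y p q c β s τ k
          = FullLifting.ζ (m := m) (n := n) r x y p q c β s t k := fun k τ => by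
        induction k with
        | zero => funext ω; simp [FullLifting.ζ, FullLifting.Z]
        | succ k ih => simp only [FullLifting.ζ, ih]
      have hψ : ∀ τ, FullLifting.ψ r x y p q c β s τ
          = FullLifting.ψ (m := m) (n := n) r x y p q c β s t := fun τ => by
        simp only [FullLifting.ψ, hζ r τ]
      rw [hφ, mul_zero]
      simp only [hψ]
      exact hasDerivAt_const _ _
    · have : NeZero l := ⟨hl.ne'⟩
      exact FullLifting.hasDerivAt_ψ x y p q c β s hc0 hc hcr hp hpr hq hqr ht
  refine ⟨main, fun h1 h2 => ?_⟩
  -- Both extra terms carry the factor `1 - p 0`.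
  simpa [FullLifting.φ₀₁, FullLifting.φ₀₂, h1, h2] using main
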